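/- Let $p$ be a prime, let $\mathbb{C}_p$ be the completion of an algebraic closure of $\mathbb{Q}_p$, and let $\Gamma_p:\mathbb{Z}_p\to\mathbb{Z}_p$ be the Morita $p$-adic gamma function, i.e. the unique continuous function with $$\Gamma_p(n)=(-1)^n\prod_{1\le j<n,\ p\nmid j} j\qquad\text{for all integers } n\ge 2 .$$ Then $\Gamma_p$ is differentially transcendental over $\mathbb{C}_p(X)$. That is, $\Gamma_p$ is infinitely differentiable on $\mathbb{Z}_p$, and there are no $n\ge 0$ and no nonzero polynomial $P(X,Y_0,\ldots,Y_n)\in\mathbb{C}_p(X)[Y_0,\ldots,Y_n]$ such that $$P\bigl(x,\Gamma_p(x),\Gamma_p'(x),\ldots,\Gamma_p^{(n)}(x)\bigr)=0$$ for all $x\in\mathbb{Z}_p$ that are not poles of the coefficients of $P$. -/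

import Mathlib

open scoped ContDiff Topology

noncomputable section

/-! ### The Morita `p`-adic gamma function -/

/-- The values `(-1)^n ∏_{1 ≤ j < n, p ∤ j} j` of the Morita gamma function at natural numbers. -/
def moritaSeq (p n : ℕ) : ℤ :=
  (-1) ^ n * ∏ j ∈ (Finset.range n).filter (fun j => ¬ p ∣ j), (j : ℤ)

/-- The factor `h_p(j)`: it is `-1` when `p ∣ j` and `-j` otherwise. -/
def moritaFactor (p j : ℕ) : ℤ := if p ∣ j then -1 else -(j : ℤ)

theorem moritaSeq_eq_prod (p n : ℕ) :
    moritaSeq p n = ∏ j ∈ Finset.range n, moritaFactor p j := by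
  have h : ∀ j, moritaFactor p j = (-1) * (if ¬ p ∣ j then (j : ℤ) else 1) := by
    intro j
    unfold moritaFactor
    split_ifs <;> simp
  simp only [h, Finset.prod_mul_distrib, Finset.prod_const, Finset.card_range, moritaSeq,
    Finset.prod_filter]

theorem moritaFactor_modEq {p k : ℕ} (hk : k ≠ 0) (a j : ℕ) :
    moritaFactor p (a * p ^ k + j) ≡ moritaFactor p j [ZMOD (p : ℤ) ^ k] := by
  have hd : p ∣ a * p ^ k := Dvd.dvd.mul_left (dvd_pow_self p hk) a
  unfold moritaFactor
  simp only [Nat.dvd_add_right hd]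
  split_ifs
  · rfl
  · refine Int.ModEq.neg ?_
    push_cast
    exact (Int.modEq_iff_dvd.2 ⟨-(a : ℤ), by ring⟩)

theorem moritaSeq_block {p k : ℕ} (hk : k ≠ 0) (a n : ℕ) :
    moritaSeq p (a * p ^ k + n) ≡ moritaSeq p (a * p ^ k) * moritaSeq p n
      [ZMOD (p : ℤ) ^ k] := by
  simp only [moritaSeq_eq_prod]
  rw [Finset.prod_range_add]
  exact Int.ModEq.mul_left _ (Int.ModEq.prod fun j _ => moritaFactor_modEq hk a j)

theorem moritaSeq_mul_pow {p k : ℕ} (hk : k ≠ 0) (a : ℕ) :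
    moritaSeq p (a * p ^ k) ≡ moritaSeq p (p ^ k) ^ a [ZMOD (p : ℤ) ^ k] := by
  induction a with
  | zero => simp [moritaSeq]
  | succ a ih =>
    rw [add_mul, one_mul, pow_succ]
    exact (moritaSeq_block hk a _).trans (ih.mul_right _)

theorem moritaSeq_prime (p : ℕ) [hp : Fact p.Prime] : moritaSeq p p ≡ 1 [ZMOD (p : ℤ)] := by
  have h1 : (Finset.range p).filter (fun j => ¬ p ∣ j) = Finset.Ico 1 p := by
    ext j
    simp only [Finset.mem_filter, Finset.mem_range, Finset.mem_Ico]
    constructor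
    · rintro ⟨h, h'⟩
      refine ⟨Nat.one_le_iff_ne_zero.2 ?_, h⟩
      rintro rfl
      exact h' (dvd_zero p)
    · rintro ⟨h, h'⟩
      exact ⟨h', fun hd => absurd (Nat.le_of_dvd h hd) (not_le.2 h')⟩
  rw [← Int.cast_one, ← ZMod.intCast_eq_intCast_iff]
  have h2 := ZMod.prod_Ico_one_prime p
  rcases hp.out.eq_two_or_odd' with rfl | hodd
  · decide
  · rw [moritaSeq, h1, hodd.neg_one_pow]
    push_cast
    rw [h2]
    norm_num

theorem moritaSeq_prime_pow (p : ℕ) [hp : Fact p.Prime] (k : ℕ) :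
    moritaSeq p (p ^ (k + 1)) ≡ 1 [ZMOD (p : ℤ) ^ k] := by
  induction k with
  | zero => simpa using Int.modEq_one
  | succ k ih =>
    rw [pow_succ' p (k + 1)]
    refine (moritaSeq_mul_pow k.succ_ne_zero p).trans ?_
    rcases k.eq_zero_or_pos with rfl | hk
    · simpa using (moritaSeq_prime p).pow p
    · have h := ih.symm.dvd
      have hpk : (p : ℤ) ∣ (p : ℤ) ^ k := dvd_pow_self _ hk.ne'
      obtain ⟨c, hc⟩ := h
      have hx : moritaSeq p (p ^ (k + 1)) = 1 + (p : ℤ) ^ k * c := by linarith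
      refine (Int.modEq_iff_dvd.2 ?_).symm
      rw [hx]
      have hgeom : (1 + (p : ℤ) ^ k * c) ^ p - 1 =
          ((p : ℤ) ^ k * c) * ∑ i ∈ Finset.range p, (1 + (p : ℤ) ^ k * c) ^ i := by
        have := mul_geom_sum (1 + (p : ℤ) ^ k * c) p
        rw [← this]; ring
      have hs : (p : ℤ) ∣ ∑ i ∈ Finset.range p, (1 + (p : ℤ) ^ k * c) ^ i := by
        have : ∑ i ∈ Finset.range p, (1 + (p : ℤ) ^ k * c) ^ i ≡
            ∑ i ∈ Finset.range p, (1 : ℤ) [ZMOD (p : ℤ)] := by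
          refine Int.ModEq.sum fun i _ => ?_
          have h1 : (1 + (p : ℤ) ^ k * c) ≡ 1 [ZMOD (p : ℤ)] :=
            (Int.modEq_iff_dvd.2 ⟨(p : ℤ) ^ (k - 1) * c, by
              obtain ⟨m, rfl⟩ := Nat.exists_eq_succ_of_ne_zero hk.ne'
              simp [pow_succ]; ring⟩).symm
          simpa using h1.pow i
        simp only [Finset.sum_const, Finset.card_range, nsmul_eq_mul, mul_one] at this
        exact (Int.modEq_zero_iff_dvd).1 (this.trans (Int.modEq_zero_iff_dvd.2 dvd_rfl))
      rw [hgeom, pow_succ]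
      exact mul_dvd_mul (Dvd.intro _ rfl) hs

theorem moritaSeq_congr (p : ℕ) [hp : Fact p.Prime] {k m n : ℕ} (hmn : m ≤ n)
    (h : p ^ (k + 1) ∣ n - m) : moritaSeq p n ≡ moritaSeq p m [ZMOD (p : ℤ) ^ k] := by
  obtain ⟨a, ha⟩ := h
  obtain rfl : n = a * p ^ (k + 1) + m := by rw [mul_comm, ← ha]; omega
  have hd : (p : ℤ) ^ k ∣ (p : ℤ) ^ (k + 1) := pow_dvd_pow _ k.le_succ
  have h1 := ((moritaSeq_block (p := p) k.succ_ne_zero a m).trans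
    ((moritaSeq_mul_pow (p := p) k.succ_ne_zero a).mul_right _)).of_dvd hd
  have h2 := ((moritaSeq_prime_pow p k).pow a).mul_right (moritaSeq p m)
  simpa using h1.trans h2

theorem moritaSeq_norm_sub_le (p : ℕ) [hp : Fact p.Prime] {k m n : ℕ}
    (h : ‖(n : ℤ_[p]) - (m : ℤ_[p])‖ ≤ (p : ℝ) ^ (-((k + 1 : ℕ) : ℤ))) :
    ‖(moritaSeq p n : ℤ_[p]) - (moritaSeq p m : ℤ_[p])‖ ≤ (p : ℝ) ^ (-(k : ℤ)) := by
  wlog hmn : m ≤ n generalizing m n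
  · rw [norm_sub_rev]
    exact this (by rwa [norm_sub_rev]) (not_le.1 hmn).le
  rw [← Int.cast_sub, PadicInt.norm_int_le_pow_iff_dvd]
  rw [← Nat.cast_sub hmn, ← Int.cast_natCast (n - m), PadicInt.norm_int_le_pow_iff_dvd] at h
  exact (moritaSeq_congr p hmn (by exact_mod_cast h)).symm.dvd

/-- There is exactly one continuous function `ℤ_p → ℤ_p` which takes the value
`(-1)^n ∏_{1 ≤ j < n, p ∤ j} j` at every integer `n ≥ 2`. -/
theorem existsUnique_moritaGamma (p : ℕ) [hp : Fact p.Prime] :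
    ∃! f : C(ℤ_[p], ℤ_[p]), ∀ n : ℕ, 2 ≤ n → f (n : ℤ_[p]) = (moritaSeq p n : ℤ_[p]) := by
  have hp1 : (1 : ℝ) < p := by exact_mod_cast hp.out.one_lt
  set S : Set ℤ_[p] := Set.range (Nat.cast : ℕ → ℤ_[p]) with hS
  have hdense : Dense S := PadicInt.denseRange_natCast
  let g : S → ℤ_[p] := fun x => (moritaSeq p x.2.choose : ℤ_[p])
  have hg : UniformContinuous g := by
    rw [Metric.uniformContinuous_iff]
    intro ε hε
    obtain ⟨k, hk⟩ := exists_pow_lt_of_lt_one hε (inv_lt_one_of_one_lt₀ hp1)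
    refine ⟨(p : ℝ) ^ (-((k + 1 : ℕ) : ℤ)), by positivity, fun {x y} hxy => ?_⟩
    rw [dist_eq_norm]
    refine lt_of_le_of_lt (moritaSeq_norm_sub_le p (k := k) ?_) (by simpa using hk)
    rw [x.2.choose_spec, y.2.choose_spec, ← dist_eq_norm]
    exact hxy.le
  have hval : ∀ n : ℕ, hdense.extend g (n : ℤ_[p]) = (moritaSeq p n : ℤ_[p]) := by
    intro n
    have h := hdense.extend_of_ind hg ⟨(n : ℤ_[p]), n, rfl⟩
    have hn : (⟨n, rfl⟩ : (n : ℤ_[p]) ∈ S).choose = n :=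
      Nat.cast_injective (R := ℤ_[p]) (⟨n, rfl⟩ : (n : ℤ_[p]) ∈ S).choose_spec
    refine h.trans ?_
    change (moritaSeq p (⟨n, rfl⟩ : (n : ℤ_[p]) ∈ S).choose : ℤ_[p]) = _
    rw [hn]
  refine ⟨⟨hdense.extend g, (hdense.uniformContinuous_extend hg).continuous⟩,
    fun n _ => hval n, ?_⟩
  intro f hf
  -- at `n = 0, 1` the value is forced by continuity: compare with `n + p ^ k` for large `k`
  have hlim : ∀ n : ℕ, Filter.Tendsto (fun k : ℕ => ((n + p ^ (k + 2) : ℕ) : ℤ_[p]))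
      Filter.atTop (𝓝 (n : ℤ_[p])) := by
    intro n
    have h0 : Filter.Tendsto (fun k : ℕ => (p : ℤ_[p]) ^ (k + 2)) Filter.atTop (𝓝 0) :=
      (tendsto_pow_atTop_nhds_zero_of_norm_lt_one (by rw [PadicInt.norm_p]; exact inv_lt_one_of_one_lt₀ hp1)).comp
        (Filter.tendsto_add_atTop_nat 2)
    simpa using h0.const_add (n : ℤ_[p])
  ext1 x
  refine congrFun (PadicInt.denseRange_natCast.equalizer f.continuous
    (hdense.uniformContinuous_extend hg).continuous (funext fun n => ?_)) x
  have h1 := (f.continuous.tendsto _).comp (hlim n)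
  have h2 := ((hdense.uniformContinuous_extend hg).continuous.tendsto _).comp (hlim n)
  refine tendsto_nhds_unique h1 (h2.congr fun k => ?_)
  have : 2 ≤ n + p ^ (k + 2) :=
    (hp.out.two_le.trans (Nat.le_self_pow (by omega) p)).trans (Nat.le_add_left _ _)
  exact (hval _).trans (hf _ this).symm

/-- The Morita `p`-adic gamma function `Γ_p : ℤ_p → ℤ_p`: the unique continuous function with
`Γ_p(n) = (-1)^n ∏_{1 ≤ j < n, p ∤ j} j` for all integers `n ≥ 2`. -/
def moritaGamma (p : ℕ) [Fact p.Prime] : C(ℤ_[p], ℤ_[p]) :=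
  (existsUnique_moritaGamma p).choose

theorem moritaGamma_natCast (p : ℕ) [Fact p.Prime] (n : ℕ) (hn : 2 ≤ n) :
    moritaGamma p (n : ℤ_[p]) = (-1) ^ n *
      ∏ j ∈ (Finset.range n).filter (fun j => ¬ p ∣ j), (j : ℤ_[p]) := by
  rw [moritaGamma, (existsUnique_moritaGamma p).choose_spec.1 n hn, moritaSeq]
  push_cast
  rfl

/-- `Γ_p` as a function `ℤ_p → ℂ_p`. -/
def moritaGammaC (p : ℕ) [Fact p.Prime] (x : ℤ_[p]) : ℂ_[p] :=
  algebraMap ℚ_[p] ℂ_[p] (moritaGamma p x : ℚ_[p])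

/-! ### Calculus of functions `ℤ_p → ℂ_p`

`ℤ_p` is open and closed in `ℚ_p`, so that extending a function on `ℤ_p` by zero to `ℚ_p` changes
neither its differentiability nor its derivatives at the points of `ℤ_p`. -/

/-- The extension by zero of a function on `ℤ_p` to `ℚ_p`. -/
def zeroExtend {p : ℕ} [Fact p.Prime] (f : ℤ_[p] → ℂ_[p]) : ℚ_[p] → ℂ_[p] :=
  Function.extend ((↑) : ℤ_[p] → ℚ_[p]) f 0

/-- The function `f : ℤ_p → ℂ_p` has continuous derivatives of all orders. -/
def IsSmoothOnPadicInt {p : ℕ} [Fact p.Prime] (f : ℤ_[p] → ℂ_[p]) : Prop :=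
  ContDiff ℚ_[p] ∞ (zeroExtend f)

/-- The `k`-th derivative `f^{(k)}` of `f : ℤ_p → ℂ_p`. -/
def padicIteratedDeriv {p : ℕ} [Fact p.Prime] (k : ℕ) (f : ℤ_[p] → ℂ_[p]) (x : ℤ_[p]) : ℂ_[p] :=
  iteratedDeriv k (zeroExtend f) (x : ℚ_[p])

/-! ### Differential polynomials over `ℂ_p(X)` -/

/-- The differential polynomials `ℂ_p(X){Y}`: polynomials over the field `ℂ_p(X)` in the
indeterminates `Y_0, Y_1, Y_2, …`, where `Y_k` stands for the `k`-th derivative of `Y`. -/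
abbrev DiffPoly (p : ℕ) [Fact p.Prime] : Type := MvPolynomial ℕ (RatFunc ℂ_[p])

/-- No coefficient of `P` has a pole at `a`. -/
def DiffPoly.IsRegularAt {p : ℕ} [Fact p.Prime] (P : DiffPoly p) (a : ℂ_[p]) : Prop :=
  ∀ m : ℕ →₀ ℕ, (P.coeff m).denom.eval a ≠ 0

/-- The value `P(a, y_0, y_1, …)`, meaningful where the coefficients of `P` have no pole at `a`. -/
def DiffPoly.evalAt {p : ℕ} [Fact p.Prime] (P : DiffPoly p) (a : ℂ_[p]) (y : ℕ → ℂ_[p]) : ℂ_[p] :=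
  ∑ m ∈ P.support, (P.coeff m).eval (RingHom.id ℂ_[p]) a * m.prod fun k e => y k ^ e

/-- `f : ℤ_p → ℂ_p` is differentially algebraic over `ℂ_p(X)`: there is a non-zero differential
polynomial `P` over `ℂ_p(X)` such that `P(x, f(x), f'(x), f''(x), …) = 0` for every `x` in `ℤ_p`
which is not one of the finitely many poles of the coefficients of `P`. -/
def IsDifferentiallyAlgebraic {p : ℕ} [Fact p.Prime] (f : ℤ_[p] → ℂ_[p]) : Prop :=
  ∃ P : DiffPoly p, P ≠ 0 ∧ ∀ x : ℤ_[p],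
    P.IsRegularAt (algebraMap ℚ_[p] ℂ_[p] x) →
      P.evalAt (algebraMap ℚ_[p] ℂ_[p] x) (fun k => padicIteratedDeriv k f x) = 0

/-- `f` is an infinitely differentiable function `ℤ_p → ℂ_p` (so that all its derivatives exist)
and is not differentially algebraic over `ℂ_p(X)`. -/
def IsDifferentiallyTranscendental {p : ℕ} [Fact p.Prime] (f : ℤ_[p] → ℂ_[p]) : Prop :=
  IsSmoothOnPadicInt f ∧ ¬ IsDifferentiallyAlgebraic f

end

/-! Transcendence is Hölder's argument for the classical gamma function. For x in pℤ_p one has Γ_p(x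
+ p) = Q(x) Γ_p(x) with Q = (-1)^p ∏_{0<j<p} (X + j); this holds on an open set, so it passes to
Taylor series (`taylorSeries_moritaGammaC_add`). Let Z stand for the function and Y_i for the i-th
derivative of Z'/Z. The translation X ↦ X + p then acts by Z ↦ Q Z and Y_i ↦ Y_i + q_i, where q_i is
the i-th derivative of Q'/Q. A nonzero differential polynomial stays nonzero when rewritten in Z and
the Y_i (`logJetSubst_ne_zero`).

The relations between Z and the Y_i along the points p(n + 1), taken as germs for n → ∞, form an
ideal stable under this action. If the ideal is nonzero, an element of least leading monomial yields
a nonzero semi-invariant (`exists_semiinvariant`). Semi-invariants have the form a Z^k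
(`semiinvariant_eq_monomial`), because Q has nonzero degree and no nontrivial constant combination
of the q_i is of the form g(X + p) - g(X): modulo translation by p, the pole of each q_i at -1 is
equivalent to no other pole (`eq_zero_of_sum_eq_ratShift_sub`). But Γ_p does not vanish at p(n + 1),
so a Z^k is a unit in the ring of germs and cannot be a relation.

Smoothness comes from Mahler expansions. Every difference of y ↦ Γ_p(p^4 y) gains a factor p^2
(`exists_fwdDiff_iter_moritaGamma`), which outweighs the factorials in the binomial polynomials and
leaves a power series of radius greater than 1. The functional equation carries this to all residue
classes mod p^4. -/

noncomputable section

/-! ### Leading terms under semilinear affine substitutions -/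

section SemilinearSubstitution

universe u

open MvPolynomial

open scoped MonomialOrder

variable {K : Type*} {ι : Type u} [Field K]

/-- The semilinear substitution `X i ↦ u i * X i + q i`, acting on coefficients by `σ`. -/
def affineSubst (σ : K →+* K) (u q : ι → K) : MvPolynomial ι K →+* MvPolynomial ι K :=
  eval₂Hom (C.comp σ) fun i => C (u i) * X i + C (q i)

@[simp]
theorem affineSubst_C (σ : K →+* K) (u q : ι → K) (c : K) :
    affineSubst σ u q (C c) = C (σ c) := by
  simp [affineSubst]

@[simp]
theorem affineSubst_X (σ : K →+* K) (u q : ι → K) (i : ι) :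
    affineSubst σ u q (X i) = C (u i) * X i + C (q i) := by
  simp [affineSubst]

/-- With infinitely many variables, the lexicographic order is a well-order only if the variables
are ordered with `>` well-founded. The order dual of a well-ordering of `ι` provides this. -/
theorem exists_monomialOrder (ι : Type u) : Nonempty (MonomialOrder.{u, u} ι) := by
  classical
  let _ : LinearOrder ι := linearOrderOfSTO (α := ι) WellOrderingRel
  have : WellFoundedLT ι := ⟨(WellOrderingRel.isWellOrder (α := ι)).wf⟩
  let e : (ι →₀ ℕ) ≃+ (ιᵒᵈ →₀ ℕ) := Finsupp.domCongr OrderDual.toDual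
  let m : MonomialOrder.{u, u} ιᵒᵈ := MonomialOrder.lex (σ := ιᵒᵈ)
  have he : ∀ a b : ι →₀ ℕ, a ≤ b → e a ≤ e b := fun a b h i => h (OrderDual.ofDual i)
  exact ⟨{ syn := m.syn, toSyn := e.trans m.toSyn,
           toSyn_monotone := fun a b h => m.toSyn_monotone (he a b h) }⟩

/-- Working with upper bounds `a`, `b` instead of exact degrees allows the coefficients `r`, `s` to
vanish. -/
theorem degree_coeff_mul (m : MonomialOrder ι) {f g : MvPolynomial ι K} {a b : ι →₀ ℕ} {r s : K}
    (hf : m.degree f ≼[m] a ∧ coeff a f = r) (hg : m.degree g ≼[m] b ∧ coeff b g = s) :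
    m.degree (f * g) ≼[m] (a + b) ∧ coeff (a + b) (f * g) = r * s := by
  refine ⟨m.degree_mul_le.trans ?_, ?_⟩
  · rw [map_add, map_add]
    exact add_le_add hf.1 hg.1
  · rw [m.coeff_mul_of_add_of_degree_le hf.1 hg.1, hf.2, hg.2]

/-- The constants `q i` contribute only smaller monomials, so the coefficient at `d` sees only the
diagonal part of the substitution. -/
theorem degree_coeff_affineSubst_monomial (m : MonomialOrder ι) (σ : K →+* K) (u q : ι → K)
    (d : ι →₀ ℕ) (c : K) :
    m.degree (affineSubst σ u q (monomial d c)) ≼[m] d ∧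
      coeff d (affineSubst σ u q (monomial d c)) = σ c * d.prod fun i e => u i ^ e := by
  have hX : ∀ i, m.degree (C (u i) * X i + C (q i)) ≼[m] Finsupp.single i 1 ∧
      coeff (Finsupp.single i 1) (C (u i) * X i + C (q i)) = u i := by
    intro i
    constructor
    · refine m.degree_add_le.trans (max_le ?_ ?_)
      · refine m.degree_mul_le.trans ?_
        rw [m.degree_C, zero_add]
        exact m.degree_X_le_single
      · rw [m.degree_C, map_zero]
        exact m.zero_le _
    · classical
      have : (0 : ι →₀ ℕ) ≠ Finsupp.single i 1 := fun h => by
        simpa using DFunLike.congr_fun h i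
      simp [coeff_C, coeff_C_mul, this]
  have hpow : ∀ i e, m.degree ((C (u i) * X i + C (q i)) ^ e) ≼[m] Finsupp.single i e ∧
      coeff (Finsupp.single i e) ((C (u i) * X i + C (q i)) ^ e) = u i ^ e := by
    intro i e
    induction e with
    | zero => simp
    | succ e ih =>
      rw [pow_succ, pow_succ, Finsupp.single_add]
      exact degree_coeff_mul m ih (hX i)
  have key : ∀ d : ι →₀ ℕ,
      m.degree (d.prod fun i e => (C (u i) * X i + C (q i)) ^ e) ≼[m] d ∧
      coeff d (d.prod fun i e => (C (u i) * X i + C (q i)) ^ e) =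
        d.prod fun i e => u i ^ e := by
    intro d
    induction d using Finsupp.induction_linear with
    | zero => simp
    | add f g hf hg =>
      rw [Finsupp.prod_add_index' (by simp) (fun _ _ _ => pow_add _ _ _),
        Finsupp.prod_add_index' (by simp) (fun _ _ _ => pow_add _ _ _)]
      exact degree_coeff_mul m hf hg
    | single i e =>
      rw [Finsupp.prod_single_index (h := fun i e => (C (u i) * X i + C (q i)) ^ e) (pow_zero _),
        Finsupp.prod_single_index (h := fun i e => u i ^ e) (pow_zero _)]
      exact hpow i e
  have hC : m.degree (C (σ c) : MvPolynomial ι K) ≼[m] 0 ∧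
      coeff 0 (C (σ c) : MvPolynomial ι K) = σ c := by simp
  have := degree_coeff_mul m hC (key d)
  rw [zero_add] at this
  rwa [affineSubst, coe_eval₂Hom, eval₂_monomial]

theorem degree_coeff_affineSubst (m : MonomialOrder ι) (σ : K →+* K) (u q : ι → K)
    (P : MvPolynomial ι K) :
    m.degree (affineSubst σ u q P) ≼[m] m.degree P ∧
      coeff (m.degree P) (affineSubst σ u q P) =
        σ (m.leadingCoeff P) * (m.degree P).prod fun i e => u i ^ e := by
  classical
  have hP : affineSubst σ u q P = ∑ d ∈ P.support, affineSubst σ u q (monomial d (coeff d P)) := by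
    conv_lhs => rw [P.as_sum, map_sum]
  constructor
  · rw [hP]
    refine m.degree_sum_le.trans (Finset.sup_le fun d hd => ?_)
    exact (degree_coeff_affineSubst_monomial m σ u q d _).1.trans (m.le_degree hd)
  · rw [hP, coeff_sum, Finset.sum_eq_single (m.degree P)]
    · exact (degree_coeff_affineSubst_monomial m σ u q _ _).2
    · intro d hd hne
      refine m.coeff_eq_zero_of_lt
        ((degree_coeff_affineSubst_monomial m σ u q d _).1.trans_lt ?_)
      exact lt_of_le_of_ne (m.le_degree hd) fun h => hne (m.toSyn.injective h)
    · intro h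
      have : P = 0 := by
        by_contra h0
        exact h (m.degree_mem_support h0)
      simp [this]

/-- A nonzero ideal stable under a semilinear affine substitution contains a nonzero
semi-invariant. -/
theorem exists_semiinvariant (σ : K →+* K) (u q : ι → K) (I : Ideal (MvPolynomial ι K))
    (hI : ∀ P ∈ I, affineSubst σ u q P ∈ I) (h0 : I ≠ ⊥) :
    ∃ P ∈ I, P ≠ 0 ∧ ∃ d : ι →₀ ℕ, affineSubst σ u q P = C (d.prod fun i e => u i ^ e) * P := by
  obtain ⟨m⟩ := exists_monomialOrder ι
  obtain ⟨P₀, hP₀, hne₀⟩ := Submodule.exists_mem_ne_zero_of_ne_bot h0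
  have hwf : WellFounded (InvImage (· < ·) fun P : MvPolynomial ι K => m.toSyn (m.degree P)) :=
    InvImage.wf _ m.wellFoundedLT_syn.wf
  obtain ⟨P, ⟨hPI, hP⟩, hmin⟩ := hwf.has_min {P | P ∈ I ∧ P ≠ 0} ⟨P₀, hP₀, hne₀⟩
  have hlc : m.leadingCoeff P ≠ 0 := m.leadingCoeff_ne_zero_iff.2 hP
  set w := (m.degree P).prod fun i e => u i ^ e
  set a := m.leadingCoeff P
  have hσa : σ a ≠ 0 := (map_ne_zero σ).2 hlc
  -- The two leading terms cancel, so a nonzero difference would be an element of `I` of smaller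
  -- degree.
  have hdiff : C a * affineSubst σ u q P - C (σ a * w) * P = 0 := by
    by_contra hne
    set R := C a * affineSubst σ u q P - C (σ a * w) * P with hR
    have hRI : R ∈ I := I.sub_mem (I.mul_mem_left _ (hI P hPI)) (I.mul_mem_left _ hPI)
    obtain ⟨h1, h2⟩ := degree_coeff_affineSubst m σ u q P
    have hle : m.degree R ≼[m] m.degree P := by
      rw [m.degree_le_iff]
      intro c hc
      by_contra hlt
      rw [not_le] at hlt
      rw [mem_support_iff, hR, coeff_sub, coeff_C_mul, coeff_C_mul,
        m.coeff_eq_zero_of_lt (h1.trans_lt hlt), m.coeff_eq_zero_of_lt hlt] at hc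
      simp at hc
    have hcoeff : coeff (m.degree P) R = 0 := by
      rw [hR, coeff_sub, coeff_C_mul, coeff_C_mul, h2]
      change a * (σ a * w) - σ a * w * a = 0
      ring
    refine hmin R ⟨hRI, hne⟩ (lt_of_le_of_ne hle fun h => ?_)
    rw [← m.toSyn.injective h] at hcoeff
    exact hne (m.coeff_degree_eq_zero_iff.1 hcoeff)
  -- Making `P` monic removes `σ a` from the multiplier and leaves `w` alone.
  refine ⟨C a⁻¹ * P, I.mul_mem_left _ hPI, mul_ne_zero (by simpa using hlc) hP, m.degree P, ?_⟩
  rw [sub_eq_zero] at hdiff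
  have h3 : affineSubst σ u q P = C a⁻¹ * (C (σ a * w) * P) := by
    rw [← hdiff, ← mul_assoc, ← C_mul, inv_mul_cancel₀ hlc, C_1, one_mul]
  rw [map_mul, affineSubst_C, h3]
  have : C (σ a⁻¹) * C (σ a * w) = (C w : MvPolynomial ι K) := by
    rw [← C_mul, map_inv₀, inv_mul_cancel_left₀ hσa]
  calc _ = C (σ a⁻¹) * C (σ a * w) * (C a⁻¹ * P) := by ring
    _ = _ := by rw [this]

end SemilinearSubstitution

/-! ### Semi-invariants of Z ↦ Q Z, Y_i ↦ Y_i + q_i -/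

section SemiInvariant

open MvPolynomial

theorem pderiv_affineSubst {K ι : Type*} [Field K] (σ : K →+* K) (u q : ι → K) (i : ι)
    (P : MvPolynomial ι K) :
    pderiv i (affineSubst σ u q P) = C (u i) * affineSubst σ u q (pderiv i P) := by
  classical
  induction P using MvPolynomial.induction_on with
  | C a => simp
  | add f g hf hg => simp only [map_add, hf, hg, mul_add]
  | mul_X f j hf =>
    simp only [map_mul, affineSubst_X, Derivation.leibniz, smul_eq_mul, hf, map_add, pderiv_X,
      pderiv_C, add_zero]
    by_cases h : i = j
    · subst h
      simp
      ring
    · simp [Pi.single_eq_of_ne' h]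
      ring

variable {K : Type*} [Field K]

/-- The semilinear substitution `Z ↦ Q * Z`, `Y i ↦ Y i + q i`, where `Z` is the variable `none`
and `Y i` the variable `some i`. -/
abbrev shiftSubst (σ : K →+* K) (Q : K) (q : ℕ → K) :
    MvPolynomial (Option ℕ) K →+* MvPolynomial (Option ℕ) K :=
  affineSubst σ (fun o => o.elim Q fun _ => 1) (fun o => o.elim 0 q)

theorem eq_single_none_of_pderiv_eq_zero [CharZero K] {P : MvPolynomial (Option ℕ) K}
    (hP : ∀ i, pderiv (some i) P = 0) {d : Option ℕ →₀ ℕ} (hd : coeff d P ≠ 0) :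
    d = Finsupp.single none (d none) := by
  ext o
  rcases o with - | i
  · simp
  · rw [Finsupp.single_apply, if_neg (by simp)]
    by_contra h
    refine hd ?_
    have hle : Finsupp.single (some i) 1 ≤ d := by
      rw [Finsupp.single_le_iff]
      omega
    have h1 := coeff_pderiv (i := some i) P (d - Finsupp.single (some i) 1)
    rw [hP, coeff_zero, tsub_add_cancel_of_le hle] at h1
    exact (mul_eq_zero.1 h1.symm).resolve_right (Nat.cast_add_one_ne_zero _)

/-- In characteristic zero such a `P` is a polynomial in Z alone, and on powers of Z the
substitution is diagonal. -/
theorem coeff_shiftSubst_of_pderiv_eq_zero [CharZero K] (σ : K →+* K) (Q : K) (q : ℕ → K)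
    {P : MvPolynomial (Option ℕ) K} (hP : ∀ i, pderiv (some i) P = 0) (l : ℕ) :
    coeff (Finsupp.single none l) (shiftSubst σ Q q P) =
      σ (coeff (Finsupp.single none l) P) * Q ^ l := by
  classical
  conv_lhs => rw [P.as_sum, map_sum, coeff_sum]
  have hterm : ∀ d ∈ P.support, coeff (Finsupp.single none l)
      (shiftSubst σ Q q (monomial d (coeff d P))) =
      if d = Finsupp.single none l then σ (coeff d P) * Q ^ l else 0 := by
    intro d hd
    have hdn := eq_single_none_of_pderiv_eq_zero hP (mem_support_iff.1 hd)
    have h1 : shiftSubst σ Q q (monomial d (coeff d P)) =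
        monomial (Finsupp.single none (d none)) (σ (coeff d P) * Q ^ d none) := by
      conv_lhs => rw [hdn]
      rw [← C_mul_X_pow_eq_monomial, map_mul, map_pow, affineSubst_C, affineSubst_X,
        ← C_mul_X_pow_eq_monomial, C_mul, C_pow, ← hdn]
      simp only [Option.elim_none, C_0, add_zero]
      ring
    rw [h1, coeff_monomial, ← hdn]
    split_ifs with h
    · rw [h]; simp
    · rfl
  rw [Finset.sum_congr rfl hterm, Finset.sum_ite_eq']
  split_ifs with h
  · rfl
  · rw [notMem_support_iff.1 h]
    simp

theorem semiinvariant_eq_monomial_of_pderiv_eq_zero [CharZero K] {σ : K →+* K} {Q : K}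
    {q : ℕ → K} {k : ℕ} (h1 : ∀ c ≠ 0, ∀ l, σ c * Q ^ l = Q ^ k * c → l = k)
    {P : MvPolynomial (Option ℕ) K} (hP : shiftSubst σ Q q P = C (Q ^ k) * P)
    (hP' : ∀ i, pderiv (some i) P = 0) :
    P = monomial (Finsupp.single none k) (coeff (Finsupp.single none k) P) := by
  classical
  ext d
  rw [coeff_monomial]
  split_ifs with h
  · rw [h]
  · by_contra hd
    have hdn := eq_single_none_of_pderiv_eq_zero hP' hd
    have h2 := coeff_shiftSubst_of_pderiv_eq_zero σ Q q hP' (d none)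
    rw [hP, coeff_C_mul, ← hdn] at h2
    rw [h1 _ hd _ h2.symm] at hdn
    exact h hdn.symm

theorem totalDegree_pderiv_lt {ι : Type*} {P : MvPolynomial ι K} {i : ι} (h : pderiv i P ≠ 0) :
    (pderiv i P).totalDegree < P.totalDegree := by
  classical
  obtain ⟨d, hd, hdeg⟩ := (pderiv i P).support.exists_mem_eq_sup
    (support_nonempty.2 h) fun s => s.sum fun _ e => e
  have h1 : coeff d (pderiv i P) ≠ 0 := mem_support_iff.1 hd
  rw [coeff_pderiv] at h1
  have h2 := le_totalDegree (mem_support_iff.2 (left_ne_zero_of_mul h1))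
  rw [Finsupp.sum_add_index' (by simp) (by simp), Finsupp.sum_single_index rfl] at h2
  rw [totalDegree, hdeg]
  omega

/-- Semi-invariants of `shiftSubst` are monomials in `Z`, provided that `Q` has no multiplicative
relations and the `q i` have no additive relations modulo `σ`-coboundaries. -/
theorem semiinvariant_eq_monomial [CharZero K] {σ : K →+* K} {Q : K} (hQ : Q ≠ 0) {q : ℕ → K}
    {k : ℕ} (h1 : ∀ c ≠ 0, ∀ l, σ c * Q ^ l = Q ^ k * c → l = k)
    (h2 : ∀ (s : Finset ℕ) (c : ℕ → K) (g : K), (∀ i, σ (c i) = c i) →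
      ∑ i ∈ s, c i * q i = σ g - g → ∀ i ∈ s, c i = 0)
    {P : MvPolynomial (Option ℕ) K} (hP : shiftSubst σ Q q P = C (Q ^ k) * P) :
    P = monomial (Finsupp.single none k) (coeff (Finsupp.single none k) P) := by
  classical
  -- Each Y_i is only translated, so differentiating in Y_i keeps the multiplier Q^k.
  have hinv : ∀ {R : MvPolynomial (Option ℕ) K}, shiftSubst σ Q q R = C (Q ^ k) * R → ∀ i,
      shiftSubst σ Q q (pderiv (some i) R) = C (Q ^ k) * pderiv (some i) R := by
    intro R hR i
    have := pderiv_affineSubst σ (fun o => o.elim Q fun _ => 1) (fun o => o.elim 0 q) (some i) R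
    rw [hR, pderiv_C_mul] at this
    simpa using this.symm
  suffices H : ∀ n, ∀ R : MvPolynomial (Option ℕ) K, R.totalDegree = n →
      shiftSubst σ Q q R = C (Q ^ k) * R → ∀ i, pderiv (some i) R = 0 from
    semiinvariant_eq_monomial_of_pderiv_eq_zero h1 hP (H _ P rfl hP)
  intro n
  induction n using Nat.strong_induction_on with
  | _ n ih =>
  intro R hn hR
  -- The derivative has smaller total degree, so by induction it involves no Y_j; hence it is c_i
  -- Z^k.
  have hmon : ∀ i, pderiv (some i) R =
      monomial (Finsupp.single none k) (coeff (Finsupp.single none k) (pderiv (some i) R)) := by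
    intro i
    by_cases h0 : pderiv (some i) R = 0
    · rw [h0]; simp
    · exact semiinvariant_eq_monomial_of_pderiv_eq_zero h1 (hinv hR i)
        (ih _ (hn ▸ totalDegree_pderiv_lt h0) _ rfl (hinv hR i))
  set c : ℕ → K := fun i => coeff (Finsupp.single none k) (pderiv (some i) R) with hc
  have hmonomial : ∀ a : K, monomial (Finsupp.single (none : Option ℕ) k) a = C a * X none ^ k :=
    fun a => (C_mul_X_pow_eq_monomial).symm
  have hσc : ∀ i, σ (c i) = c i := by
    intro i
    have h3 := congrArg (coeff (Finsupp.single none k)) (hinv hR i)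
    rw [coeff_C_mul] at h3
    have h4 : ∀ j, pderiv (some j) (pderiv (some i) R) = 0 := by
      intro j
      rw [hmon i, hmonomial]
      simp [Derivation.leibniz_pow]
    rw [coeff_shiftSubst_of_pderiv_eq_zero σ Q q h4, mul_comm] at h3
    exact mul_left_cancel₀ (pow_ne_zero k hQ) h3
  -- the part of `R` which depends on the variables `some i`
  set s : Finset ℕ := R.vars.eraseNone with hs
  have hzero : ∀ i ∉ s, pderiv (some i) R = 0 := fun i hi =>
    pderiv_eq_zero_of_notMem_vars fun h => hi (Finset.mem_eraseNone.2 h)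
  set T : MvPolynomial (Option ℕ) K := ∑ i ∈ s, C (c i) * X (some i) * X none ^ k with hT
  -- Thus R = Z^k ∑ c_i Y_i + (a polynomial in Z).
  have hRT : ∀ i, pderiv (some i) (R - T) = 0 := by
    intro i
    have hTi : pderiv (some i) T = if i ∈ s then C (c i) * X none ^ k else 0 := by
      rw [hT, map_sum, ← Finset.sum_ite_eq s i fun j => C (c j) * X none ^ k]
      refine Finset.sum_congr rfl fun j _ => ?_
      by_cases hij : i = j
      · subst hij
        simp [Derivation.leibniz_pow, Derivation.leibniz]
        ring
      · simp [Derivation.leibniz_pow, Derivation.leibniz, hij, Ne.symm hij]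
    rw [map_sub, hTi]
    split_ifs with h
    · rw [hmon i, hmonomial, sub_self]
    · rw [hzero i h, sub_zero]
  have hτT : shiftSubst σ Q q T =
      C (Q ^ k) * T + C (Q ^ k * ∑ i ∈ s, c i * q i) * X none ^ k := by
    rw [hT, map_sum, Finset.mul_sum, Finset.mul_sum, map_sum, Finset.sum_mul,
      ← Finset.sum_add_distrib]
    refine Finset.sum_congr rfl fun i _ => ?_
    simp only [map_mul, map_pow, affineSubst_C, affineSubst_X, Option.elim_none, Option.elim_some,
      hσc, C_0, C_1]
    ring
  have h5 := coeff_shiftSubst_of_pderiv_eq_zero σ Q q hRT k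
  set g := coeff (Finsupp.single none k) (R - T) with hg
  have h6 : shiftSubst σ Q q (R - T) =
      C (Q ^ k) * (R - T) - C (Q ^ k * ∑ i ∈ s, c i * q i) * X none ^ k := by
    rw [map_sub, hR, hτT]
    ring
  rw [h6, coeff_sub, coeff_C_mul, C_mul_X_pow_eq_monomial, coeff_monomial, if_pos rfl, ← hg] at h5
  -- The coefficients of Z^k express the combination of the `q i` as a coboundary; `h2` then kills
  -- all `c i`.
  have h7 : ∑ i ∈ s, c i * q i = σ (-g) - -g := by
    refine mul_left_cancel₀ (pow_ne_zero k hQ) ?_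
    rw [map_neg]
    linear_combination -h5
  have h8 := h2 s c (-g) hσc h7
  intro i
  by_cases hi : i ∈ s
  · rw [hmon i]
    change monomial _ (c i) = 0
    rw [h8 i hi, monomial_zero]
  · exact hzero i hi

end SemiInvariant

/-! ### Jets in terms of logarithmic derivatives -/

section LogarithmicDerivatives

open MvPolynomial

/-- The derivation `Z ↦ Z * Y 0`, `Y i ↦ Y (i + 1)` of `ℤ[Z, Y 0, Y 1, …]`; it is the derivation
of differential polynomials in `Z` when `Y i` stands for the `i`-th derivative of `Z' / Z`. -/
def logJetDerivation :
    Derivation ℤ (MvPolynomial (Option ℕ) ℤ) (MvPolynomial (Option ℕ) ℤ) :=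
  mkDerivation ℤ fun o => o.elim (X none * X (some 0)) fun i => X (some (i + 1))

/-- The `k`-th derivative of `Z` as a polynomial in `Z` and the derivatives of `Z' / Z`. -/
def logJet (k : ℕ) : MvPolynomial (Option ℕ) ℤ := logJetDerivation^[k] (X none)

variable {E : Type*} [Field E]

/-- The power series with derivatives `y k` at the origin. -/
def powerSeriesOfJet (y : ℕ → E) : PowerSeries E := PowerSeries.mk fun k => y k / (k.factorial : E)

/-- The derivatives at the origin of the logarithmic derivative of the power series with
derivatives `y k` at the origin. -/
def logDerivJet (y : ℕ → E) (i : ℕ) : E :=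
  PowerSeries.constantCoeff ((PowerSeries.derivative E)^[i]
    (PowerSeries.derivative E (powerSeriesOfJet y) * (powerSeriesOfJet y)⁻¹))

theorem constantCoeff_iterate_derivative_powerSeriesOfJet [CharZero E] (y : ℕ → E) (k : ℕ) :
    PowerSeries.constantCoeff ((PowerSeries.derivative E)^[k] (powerSeriesOfJet y)) = y k := by
  rw [PowerSeries.constantCoeff_iterate_derivative, powerSeriesOfJet, PowerSeries.coeff_mk]
  have : (k.factorial : E) ≠ 0 := by exact_mod_cast k.factorial_ne_zero
  field_simp

/-- Both sides obey the Leibniz rule, so only the variables matter, and the one for Z is U' = U ·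
(U'/U). -/
theorem aeval_iterate_logJetDerivation {U : PowerSeries E} (hU : PowerSeries.constantCoeff U ≠ 0)
    (P : MvPolynomial (Option ℕ) ℤ) :
    aeval (fun o : Option ℕ => o.elim U fun i =>
      (PowerSeries.derivative E)^[i] (PowerSeries.derivative E U * U⁻¹)) (logJetDerivation P) =
    PowerSeries.derivative E (aeval (fun o : Option ℕ => o.elim U fun i =>
      (PowerSeries.derivative E)^[i] (PowerSeries.derivative E U * U⁻¹)) P) := by
  induction P using MvPolynomial.induction_on with
  | C a =>
    rw [← algebraMap_eq, Derivation.map_algebraMap, map_zero, AlgHom.commutes,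
      eq_intCast (algebraMap ℤ (PowerSeries E)), Derivation.map_intCast]
  | add f g hf hg => simp only [map_add, hf, hg]
  | mul_X f o hf =>
    simp only [Derivation.leibniz, map_add, smul_eq_mul, map_mul, hf]
    congr 2
    rcases o with - | i
    · simp only [logJetDerivation, mkDerivation_X, Option.elim_none, map_mul, aeval_X,
        Option.elim_some, Function.iterate_zero, id_eq]
      rw [mul_comm (PowerSeries.derivative E U), ← mul_assoc, PowerSeries.mul_inv_cancel _ hU,
        one_mul]
    · simp only [logJetDerivation, mkDerivation_X, aeval_X, Option.elim_some,
        Function.iterate_succ_apply']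

/-- The derivatives at the origin are expressed in the derivatives of the logarithmic
derivative. -/
theorem aeval_logJet [CharZero E] {y : ℕ → E} (hy : y 0 ≠ 0) (k : ℕ) :
    aeval (fun o : Option ℕ => o.elim (y 0) (logDerivJet y)) (logJet k) = y k := by
  set U := powerSeriesOfJet y with hUdef
  have hU0 : PowerSeries.constantCoeff U = y 0 :=
    constantCoeff_iterate_derivative_powerSeriesOfJet y 0
  have hU : PowerSeries.constantCoeff U ≠ 0 := by rwa [hU0]
  set v : Option ℕ → PowerSeries E := fun o => o.elim U fun i =>
      (PowerSeries.derivative E)^[i] (PowerSeries.derivative E U * U⁻¹) with hv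
  have h1 : ∀ k, aeval v (logJet k) = (PowerSeries.derivative E)^[k] U := by
    intro k
    induction k with
    | zero => simp [logJet, hv]
    | succ k ih =>
      rw [Function.iterate_succ_apply', ← ih, logJet, Function.iterate_succ_apply']
      exact aeval_iterate_logJetDerivation hU _
  have h2 : (fun o : Option ℕ => o.elim (y 0) (logDerivJet y)) =
      fun o => PowerSeries.constantCoeff (v o) := by
    funext o
    rcases o with - | i
    · exact hU0.symm
    · rfl
  rw [h2, ← constantCoeff_iterate_derivative_powerSeriesOfJet y k, ← h1]
  rw [map_aeval, aeval_def, ← coe_eval₂Hom]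
  congr 2

/-- The substitution of `logJet k` for `Y k` in differential polynomials. -/
def logJetSubst (K : Type*) [CommRing K] : MvPolynomial ℕ K →ₐ[K] MvPolynomial (Option ℕ) K :=
  aeval fun k => map (algebraMap ℤ K) (logJet k)

/-- Every jet with y_0 ≠ 0 is reached from its own logarithmic derivatives, so P can be tested at
such a jet. -/
theorem logJetSubst_ne_zero [CharZero E] {P : MvPolynomial ℕ E} (hP : P ≠ 0) :
    logJetSubst E P ≠ 0 := by
  -- The factor `X 0` forces `y 0 ≠ 0` at the chosen point.
  obtain ⟨y, hy⟩ : ∃ y : ℕ → E, eval y (P * X 0) ≠ 0 := by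
    by_contra! h
    exact mul_ne_zero hP (X_ne_zero 0) (funext fun y => by rw [h y, map_zero])
  rw [map_mul, eval_X] at hy
  intro h
  refine left_ne_zero_of_mul hy ?_
  have h1 := congrArg (aeval fun o : Option ℕ => o.elim (y 0) (logDerivJet y)) h
  rw [map_zero, logJetSubst, ← AlgHom.comp_apply, comp_aeval] at h1
  simp only [aeval_map_algebraMap, aeval_logJet (right_ne_zero_of_mul hy)] at h1
  rwa [← aeval_eq_eval]

theorem derivative_mul_mul_inv {U V : PowerSeries E} (hU : PowerSeries.constantCoeff U ≠ 0)
    (hV : PowerSeries.constantCoeff V ≠ 0) :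
    PowerSeries.derivative E (U * V) * (U * V)⁻¹ =
      PowerSeries.derivative E U * U⁻¹ + PowerSeries.derivative E V * V⁻¹ := by
  rw [PowerSeries.mul_inv_rev, Derivation.leibniz, smul_eq_mul, smul_eq_mul]
  linear_combination (PowerSeries.derivative E V * V⁻¹) * PowerSeries.mul_inv_cancel U hU +
    (PowerSeries.derivative E U * U⁻¹) * PowerSeries.mul_inv_cancel V hV

theorem derivative_prod_mul_inv {α : Type*} (s : Finset α) (U : α → PowerSeries E)
    (hU : ∀ j ∈ s, PowerSeries.constantCoeff (U j) ≠ 0) :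
    PowerSeries.derivative E (∏ j ∈ s, U j) * (∏ j ∈ s, U j)⁻¹ =
      ∑ j ∈ s, PowerSeries.derivative E (U j) * (U j)⁻¹ := by
  classical
  induction s using Finset.induction_on with
  | empty => simp
  | insert a s ha ih =>
    rw [Finset.prod_insert ha, Finset.sum_insert ha, derivative_mul_mul_inv (hU a (by simp)),
      ih fun j hj => hU j (by simp [hj])]
    rw [map_prod]
    exact Finset.prod_ne_zero_iff.2 fun j hj => hU j (by simp [hj])

theorem iterate_derivative_inv_X_add_C (a : E) (i : ℕ) :
    (PowerSeries.derivative E)^[i] (PowerSeries.X + PowerSeries.C a)⁻¹ =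
      PowerSeries.C ((-1) ^ i * (i.factorial : E)) *
        (PowerSeries.X + PowerSeries.C a)⁻¹ ^ (i + 1) := by
  induction i with
  | zero => simp
  | succ i ih =>
    rw [Function.iterate_succ_apply', ih, Derivation.leibniz, PowerSeries.derivative_C,
      PowerSeries.derivative_pow, PowerSeries.derivative_inv', map_add, PowerSeries.derivative_X,
      PowerSeries.derivative_C, Nat.factorial_succ]
    simp only [smul_eq_mul, map_mul, map_pow, map_neg, map_one, Nat.cast_mul, Nat.cast_add,
      Nat.cast_one, map_add, map_natCast, add_tsub_cancel_right]
    ring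

/-- The effect on the jet of the logarithmic derivative of multiplying with a product of linear
polynomials. -/
theorem logDerivJet_of_eq_mul {α : Type*} (t : Finset α) (c : E) (hc : c ≠ 0) (a : α → E)
    (ha : ∀ j ∈ t, a j ≠ 0) {y y' : ℕ → E} (hy : y 0 ≠ 0)
    (h : powerSeriesOfJet y' = PowerSeries.C c * (∏ j ∈ t, (PowerSeries.X + PowerSeries.C (a j))) *
      powerSeriesOfJet y) (i : ℕ) :
    logDerivJet y' i =
      logDerivJet y i + (-1) ^ i * (i.factorial : E) * ∑ j ∈ t, (a j)⁻¹ ^ (i + 1) := by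
  have hy' : PowerSeries.constantCoeff (powerSeriesOfJet y) ≠ 0 := by
    simpa [powerSeriesOfJet] using hy
  have hprod : PowerSeries.constantCoeff (∏ j ∈ t, (PowerSeries.X + PowerSeries.C (a j))) ≠ 0 := by
    rw [map_prod]
    exact Finset.prod_ne_zero_iff.2 fun j hj => by simpa using ha j hj
  have hC : PowerSeries.constantCoeff (PowerSeries.C c) ≠ 0 := by simpa using hc
  have hlin : ∀ j, PowerSeries.derivative E (PowerSeries.X + PowerSeries.C (a j)) *
      (PowerSeries.X + PowerSeries.C (a j))⁻¹ = (PowerSeries.X + PowerSeries.C (a j))⁻¹ := by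
    intro j
    simp
  have hsum : ∀ U : α → PowerSeries E, (PowerSeries.derivative E)^[i] (∑ j ∈ t, U j) =
      ∑ j ∈ t, (PowerSeries.derivative E)^[i] (U j) := by
    intro U
    induction i with
    | zero => rfl
    | succ i ih => simp only [Function.iterate_succ_apply', ih, map_sum]
  rw [logDerivJet, h, derivative_mul_mul_inv (by rw [map_mul]; exact mul_ne_zero hC hprod) hy',
    derivative_mul_mul_inv hC hprod, derivative_prod_mul_inv t _ fun j hj => by
      simpa using ha j hj, PowerSeries.derivative_C, zero_mul, zero_add,
    Finset.sum_congr rfl fun j _ => hlin j, iterate_map_add, hsum, map_add, map_sum, add_comm,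
    Finset.mul_sum]
  simp only [iterate_derivative_inv_X_add_C]
  congr 1
  refine Finset.sum_congr rfl fun j _ => ?_
  simp

end LogarithmicDerivatives

/-! ### Translations and poles of rational functions -/

section RationalFunctions

open Polynomial

variable {F : Type*} [Field F]

/-- The automorphism `X ↦ X + c` of the field of rational functions. -/
def ratShift (c : F) : RatFunc F →+* RatFunc F :=
  RatFunc.mapRingHom (taylorAlgHom c)
    (nonZeroDivisors_le_comap_nonZeroDivisors_of_injective _ (by
      exact taylor_injective c))

theorem ratShift_div (c : F) (n d : F[X]) :
    ratShift c (algebraMap F[X] (RatFunc F) n / algebraMap F[X] (RatFunc F) d) =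
      algebraMap F[X] (RatFunc F) (taylor c n) / algebraMap F[X] (RatFunc F) (taylor c d) := by
  rw [ratShift, RatFunc.coe_mapRingHom_eq_coe_map, RatFunc.map_apply_div]
  simp

theorem ratShift_algebraMap (c : F) (n : F[X]) :
    ratShift c (algebraMap F[X] (RatFunc F) n) = algebraMap F[X] (RatFunc F) (taylor c n) := by
  simpa using ratShift_div c n 1

theorem ratShift_eq (c : F) (r : RatFunc F) :
    ratShift c r = algebraMap F[X] (RatFunc F) (taylor c r.num) /
      algebraMap F[X] (RatFunc F) (taylor c r.denom) := by
  conv_lhs => rw [← RatFunc.num_div_denom r, ratShift_div]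

theorem ratShift_neg_ratShift (c : F) (r : RatFunc F) : ratShift (-c) (ratShift c r) = r := by
  rw [ratShift_eq c, ratShift_div, taylor_taylor, taylor_taylor, neg_add_cancel, taylor_zero,
    taylor_zero, RatFunc.num_div_denom]

theorem intDegree_ratShift (c : F) (r : RatFunc F) :
    (ratShift c r).intDegree = r.intDegree := by
  by_cases hr : r = 0
  · simp [hr]
  have hn : taylor c r.num ≠ 0 := by
    rw [Ne, taylor_eq_zero]
    exact RatFunc.num_ne_zero hr
  have hd : taylor c r.denom ≠ 0 := by
    rw [Ne, taylor_eq_zero]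
    exact r.denom_ne_zero
  rw [ratShift_eq, RatFunc.intDegree_div (RatFunc.algebraMap_ne_zero hn)
    (RatFunc.algebraMap_ne_zero hd), RatFunc.intDegree_polynomial, RatFunc.intDegree_polynomial,
    natDegree_taylor, natDegree_taylor]
  rfl

theorem intDegree_pow {Q : RatFunc F} (hQ : Q ≠ 0) (k : ℕ) :
    (Q ^ k).intDegree = k * Q.intDegree := by
  induction k with
  | zero => simp
  | succ k ih =>
    rw [pow_succ, RatFunc.intDegree_mul (pow_ne_zero k hQ) hQ, ih]
    push_cast
    ring

/-- Translation preserves the degree, so comparing degrees gives l · deg Q = k · deg Q. -/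
theorem ratShift_mul_pow_eq {a : F} {Q c : RatFunc F} (hQ : Q.intDegree ≠ 0) (hc : c ≠ 0)
    {k l : ℕ} (h : ratShift a c * Q ^ l = Q ^ k * c) : l = k := by
  have hQ0 : Q ≠ 0 := by
    rintro rfl
    simp at hQ
  have h1 := congrArg RatFunc.intDegree h
  rw [RatFunc.intDegree_mul ((_root_.map_ne_zero _).2 hc) (pow_ne_zero _ hQ0),
    RatFunc.intDegree_mul (pow_ne_zero _ hQ0) hc, intDegree_ratShift, intDegree_pow hQ0,
    intDegree_pow hQ0, add_comm, add_left_inj] at h1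
  exact_mod_cast mul_right_cancel₀ hQ h1

theorem infinite_range_add_nat_mul [CharZero F] {c : F} (hc : c ≠ 0) (a : F) :
    (Set.range fun n : ℕ => a + n * c).Infinite :=
  Set.infinite_range_of_injective fun m n h => by
    simpa [hc] using h

/-- Past its finitely many poles among the multiples of c, `r` takes one value v at all further n c;
the polynomial `r.num - v * r.denom` then has infinitely many roots. -/
theorem eq_C_of_ratShift_eq [CharZero F] {c : F} (hc : c ≠ 0) {r : RatFunc F}
    (h : ratShift c r = r) : ∃ v, r = RatFunc.C v := by
  have hd := r.denom_ne_zero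
  have hcross : taylor c r.num * r.denom = r.num * taylor c r.denom := by
    apply RatFunc.algebraMap_injective F
    have h1 : algebraMap F[X] (RatFunc F) (taylor c r.denom) ≠ 0 :=
      RatFunc.algebraMap_ne_zero (by rwa [Ne, taylor_eq_zero])
    have h2 := RatFunc.algebraMap_ne_zero hd
    rw [ratShift_eq] at h
    nth_rw 3 [← RatFunc.num_div_denom r] at h
    rw [div_eq_div_iff h1 h2] at h
    rw [map_mul, map_mul, h]
  obtain ⟨N, hN⟩ : ∃ N : ℕ, ∀ n ≥ N, r.denom.eval (n * c) ≠ 0 := by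
    have hfin : {n : ℕ | r.denom.eval (n * c) = 0}.Finite := by
      refine Set.Finite.of_finite_image (f := fun n : ℕ => (n : F) * c)
        ((r.denom.rootSet_finite F).subset ?_) fun m _ n _ h => by simpa [hc] using h
      rintro _ ⟨n, hn, rfl⟩
      rw [mem_rootSet]
      exact ⟨hd, by simpa using hn⟩
    obtain ⟨N, hN⟩ := hfin.bddAbove
    exact ⟨N + 1, fun n hn h => by have := hN h; omega⟩
  set v := r.num.eval (N * c) / r.denom.eval (N * c) with hv
  have hval : ∀ n : ℕ, r.num.eval (N * c + n * c) = v * r.denom.eval (N * c + n * c) := by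
    intro n
    induction n with
    | zero => rw [Nat.cast_zero, zero_mul, add_zero, hv, div_mul_cancel₀ _ (hN N le_rfl)]
    | succ n ih =>
      have h1 := congrArg (eval (N * c + n * c)) hcross
      rw [eval_mul, eval_mul, taylor_eval, taylor_eval, ih] at h1
      have h2 : r.denom.eval (N * c + n * c) ≠ 0 := by
        have := hN (N + n) (by omega)
        rwa [Nat.cast_add, add_mul] at this
      have h3 : (N : F) * c + ((n + 1 : ℕ) : F) * c = N * c + n * c + c := by
        push_cast
        ring
      rw [h3]
      refine mul_right_cancel₀ h2 ?_
      rw [h1]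
      ring
  refine ⟨v, ?_⟩
  have hpoly : r.num - C v * r.denom = 0 := by
    refine eq_zero_of_infinite_isRoot _ ((infinite_range_add_nat_mul hc (N * c)).mono ?_)
    rintro _ ⟨n, rfl⟩
    simp [IsRoot, hval n]
  rw [sub_eq_zero] at hpoly
  rw [← RatFunc.num_div_denom r, hpoly, _root_.map_mul,
    mul_div_cancel_right₀ _ (RatFunc.algebraMap_ne_zero hd), RatFunc.algebraMap_C]

/-- The ring of rational functions without pole at `a`. -/
def regularAt (a : F) : Subring (RatFunc F) where
  carrier := {r | r.denom.eval a ≠ 0}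
  mul_mem' {r s} hr hs h :=
    mul_ne_zero hr hs (eval_mul.symm.trans
      (eval_eq_zero_of_dvd_of_eval_eq_zero (RatFunc.denom_mul_dvd r s) h))
  one_mem' := by simp
  add_mem' {r s} hr hs h :=
    mul_ne_zero hr hs (eval_mul.symm.trans
      (eval_eq_zero_of_dvd_of_eval_eq_zero (RatFunc.denom_add_dvd r s) h))
  zero_mem' := by simp
  neg_mem' {r} hr h := by
    have h1 : (-r).denom ∣ r.denom := by
      rw [RatFunc.denom_dvd r.denom_ne_zero]
      exact ⟨-r.num, by rw [map_neg, neg_div, RatFunc.num_div_denom]⟩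
    exact hr (eval_eq_zero_of_dvd_of_eval_eq_zero h1 h)

theorem mem_regularAt {a : F} {r : RatFunc F} : r ∈ regularAt a ↔ r.denom.eval a ≠ 0 := Iff.rfl

theorem div_mem_regularAt {a : F} (n : F[X]) {d : F[X]} (hd : d.eval a ≠ 0) :
    algebraMap F[X] (RatFunc F) n / algebraMap F[X] (RatFunc F) d ∈ regularAt a :=
  fun h => hd (eval_eq_zero_of_dvd_of_eval_eq_zero (RatFunc.denom_div_dvd n d) h)

theorem C_mem_regularAt (a c : F) : RatFunc.C c ∈ regularAt a := by
  simp [mem_regularAt]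

theorem ratShift_mem_regularAt {a c : F} {r : RatFunc F} :
    ratShift c r ∈ regularAt a ↔ r ∈ regularAt (a + c) := by
  have key : ∀ {a c : F} {r : RatFunc F}, r ∈ regularAt (a + c) → ratShift c r ∈ regularAt a := by
    intro a c r h
    rw [ratShift_eq]
    exact div_mem_regularAt _ (by rwa [taylor_eval])
  refine ⟨fun h => ?_, key⟩
  have := key (a := a + c) (c := -c) (r := ratShift c r) (by simpa using h)
  rwa [ratShift_neg_ratShift] at this

theorem inv_X_add_C_mem_regularAt {a b : F} (h : a + b ≠ 0) :
    (RatFunc.X + RatFunc.C b)⁻¹ ∈ regularAt a := by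
  have := div_mem_regularAt (a := a) 1 (d := X + C b) (by simpa using h)
  simpa [RatFunc.algebraMap_X, RatFunc.algebraMap_C] using this

theorem X_add_C_ne_zero' (b : F) : RatFunc.X + RatFunc.C b ≠ 0 := by
  have := RatFunc.algebraMap_ne_zero (K := F) (X_add_C_ne_zero b)
  rwa [map_add, RatFunc.algebraMap_X, RatFunc.algebraMap_C] at this

/-- If n is the largest index with γ n ≠ 0, multiplying the sum by (X + b)^(n + 1) gives a
polynomial with value γ n at -b, while regularity would make this value 0. -/
theorem principalPart_notMem_regularAt (b : F) (s : Finset ℕ) (γ : ℕ → F)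
    (h : ∑ i ∈ s, RatFunc.C (γ i) * (RatFunc.X + RatFunc.C b)⁻¹ ^ (i + 1) ∈ regularAt (-b)) :
    ∀ i ∈ s, γ i = 0 := by
  classical
  by_contra! hne
  set s' := s.filter fun i => γ i ≠ 0 with hs'
  have hs'ne : s'.Nonempty := by
    obtain ⟨i, hi, hi'⟩ := hne
    exact ⟨i, Finset.mem_filter.2 ⟨hi, hi'⟩⟩
  set n := s'.max' hs'ne with hn
  have hnmem : n ∈ s' := Finset.max'_mem _ _
  set T := ∑ i ∈ s, RatFunc.C (γ i) * (RatFunc.X + RatFunc.C b)⁻¹ ^ (i + 1) with hT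
  have hTs' : T = ∑ i ∈ s', RatFunc.C (γ i) * (RatFunc.X + RatFunc.C b)⁻¹ ^ (i + 1) := by
    refine (Finset.sum_subset (Finset.filter_subset _ _) fun i hi hi' => ?_).symm
    have : γ i = 0 := by
      by_contra h0
      exact hi' (Finset.mem_filter.2 ⟨hi, h0⟩)
    simp [this]
  set R : F[X] := ∑ i ∈ s', C (γ i) * (X + C b) ^ (n - i) with hR
  have hX := X_add_C_ne_zero' b
  have h1 : T * (RatFunc.X + RatFunc.C b) ^ (n + 1) = algebraMap F[X] (RatFunc F) R := by
    rw [hTs', hR, Finset.sum_mul, map_sum]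
    refine Finset.sum_congr rfl fun i hi => ?_
    have hle : i ≤ n := Finset.le_max' _ _ hi
    rw [map_mul, map_pow, map_add, RatFunc.algebraMap_X, RatFunc.algebraMap_C,
      RatFunc.algebraMap_C, mul_assoc]
    congr 1
    obtain ⟨k, hk⟩ := Nat.exists_eq_add_of_le hle
    rw [hk, Nat.add_sub_cancel_left, add_right_comm, pow_add _ (i + 1) k, ← mul_assoc, ← mul_pow,
      inv_mul_cancel₀ hX, one_pow, one_mul]
  have h2 : T.num * (X + C b) ^ (n + 1) = R * T.denom := by
    apply RatFunc.algebraMap_injective F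
    have hd := RatFunc.algebraMap_ne_zero T.denom_ne_zero
    rw [map_mul, map_mul, ← h1, map_pow, map_add, RatFunc.algebraMap_X, RatFunc.algebraMap_C]
    conv_rhs => rw [← RatFunc.num_div_denom T]
    field_simp
    simp [RatFunc.num_div_denom]
  have h3 := congrArg (eval (-b)) h2
  have hRn : eval (-b) R = γ n := by
    rw [hR, eval_finsetSum, Finset.sum_eq_single n]
    · simp
    · intro i hi hin
      have hlt : i < n := lt_of_le_of_ne (Finset.le_max' _ _ hi) hin
      simp [Nat.sub_ne_zero_of_lt hlt]
    · exact fun h => absurd hnmem h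
  rw [eval_mul, eval_mul, hRn] at h3
  simp only [eval_pow, eval_add, eval_X, eval_C, neg_add_cancel, ne_eq, Nat.succ_ne_zero,
    not_false_eq_true, zero_pow, mul_zero] at h3
  exact mul_ne_zero (Finset.mem_filter.1 hnmem).2 h h3.symm

/-- A rational function with exactly one pole in some orbit of the translation by `c` is not of the
form `g(X + c) - g(X)`. -/
theorem ratShift_sub_self_mem_regularAt [CharZero F] {c : F} (hc : c ≠ 0) (a : F) (g : RatFunc F)
    (h : ∀ k : ℤ, k ≠ 0 → ratShift c g - g ∈ regularAt (a + k * c)) :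
    ratShift c g - g ∈ regularAt a := by
  have hinf : ∀ (e b : F), e ≠ 0 → ¬ ∀ n : ℕ, g ∉ regularAt (b + n * e) := by
    intro e b he hall
    refine g.denom_ne_zero (eq_zero_of_infinite_isRoot _
      ((infinite_range_add_nat_mul he b).mono ?_))
    rintro _ ⟨n, rfl⟩
    by_contra hn
    exact hall n hn
  by_contra hS
  -- If `g` is regular at a, its translate has a pole there. So `g` has a pole at a + c, and
  -- regularity of the difference at later points pushes the pole on to every a + n c, n ≥ 1.
  by_cases hg : g ∈ regularAt a
  · have hσ : ratShift c g ∉ regularAt a := fun h1 => hS ((regularAt a).sub_mem h1 hg)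
    refine hinf c (a + c) hc fun n => ?_
    induction n with
    | zero =>
      rw [ratShift_mem_regularAt] at hσ
      simpa using hσ
    | succ n ih =>
      have h1 := h (n + 1) (by omega)
      have e1 : a + ((n + 1 : ℤ) : F) * c = a + c + n * c := by push_cast; ring
      rw [e1] at h1
      intro h2
      have e2 : a + c + ((n + 1 : ℕ) : F) * c = a + c + n * c + c := by push_cast; ring
      rw [e2, ← ratShift_mem_regularAt] at h2
      have := (regularAt _).sub_mem h2 h1
      rw [sub_sub_cancel] at this
      exact ih this
  -- Otherwise the pole of `g` at a spreads backwards to every a - n c.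
  · refine hinf (-c) a (neg_ne_zero.2 hc) fun n => ?_
    induction n with
    | zero => simpa using hg
    | succ n ih =>
      intro h2
      have h1 := h (-(n + 1 : ℤ)) (by omega)
      have e1 : a + ((-(n + 1 : ℤ) : ℤ) : F) * c = a + ((n + 1 : ℕ) : F) * (-c) := by
        push_cast
        ring
      rw [e1] at h1
      have := (regularAt _).add_mem h1 h2
      rw [sub_add_cancel, ratShift_mem_regularAt] at this
      refine ih ?_
      convert this using 2
      push_cast
      ring

/-- Linear combinations of the derivatives of `∑ j, 1 / (X + b j)` are not of the form
`g(X + c) - g(X)`. -/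
theorem eq_zero_of_sum_eq_ratShift_sub [CharZero F] {c : F} (hc : c ≠ 0) {t : Finset ℕ}
    {b : ℕ → F} {j₀ : ℕ} (hj₀ : j₀ ∈ t)
    (hb : ∀ j ∈ t, ∀ k : ℤ, -b j₀ + k * c + b j = 0 → j = j₀ ∧ k = 0)
    (s : Finset ℕ) (γ : ℕ → RatFunc F) (g : RatFunc F) (hγ : ∀ i, ratShift c (γ i) = γ i)
    (h : ∑ i ∈ s, γ i * (RatFunc.C ((-1) ^ i * (i.factorial : F)) *
      ∑ j ∈ t, (RatFunc.X + RatFunc.C (b j))⁻¹ ^ (i + 1)) = ratShift c g - g) :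
    ∀ i ∈ s, γ i = 0 := by
  choose v hv using fun i => eq_C_of_ratShift_eq hc (hγ i)
  have hmem : ∀ a, (∀ j ∈ t, a + b j ≠ 0) → ratShift c g - g ∈ regularAt a := by
    intro a ha
    rw [← h]
    refine Subring.sum_mem _ fun i _ => Subring.mul_mem _ ?_ (Subring.mul_mem _ ?_ ?_)
    · rw [hv]
      exact C_mem_regularAt _ _
    · exact C_mem_regularAt _ _
    · exact Subring.sum_mem _ fun j hj =>
        Subring.pow_mem _ (inv_X_add_C_mem_regularAt (ha j hj)) _
  -- By `hb` the sum can have a pole in the orbit of -b j₀ only at -b j₀ itself, so it is regular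
  -- there too. There only the `j₀` terms are singular, and their principal part must vanish.
  have hreg := ratShift_sub_self_mem_regularAt hc (-b j₀) g fun k hk =>
    hmem _ fun j hj h0 => hk (hb j hj k h0).2
  have hsplit : ratShift c g - g =
      ∑ i ∈ s, RatFunc.C (v i * ((-1) ^ i * (i.factorial : F))) *
        (RatFunc.X + RatFunc.C (b j₀))⁻¹ ^ (i + 1) +
      ∑ i ∈ s, RatFunc.C (v i * ((-1) ^ i * (i.factorial : F))) *
        ∑ j ∈ t.erase j₀, (RatFunc.X + RatFunc.C (b j))⁻¹ ^ (i + 1) := by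
    rw [← h, ← Finset.sum_add_distrib]
    refine Finset.sum_congr rfl fun i _ => ?_
    rw [← Finset.add_sum_erase t _ hj₀, hv, map_mul RatFunc.C (v i)]
    ring
  rw [hsplit] at hreg
  have hrest : ∑ i ∈ s, RatFunc.C (v i * ((-1) ^ i * (i.factorial : F))) *
      ∑ j ∈ t.erase j₀, (RatFunc.X + RatFunc.C (b j))⁻¹ ^ (i + 1) ∈ regularAt (-b j₀) := by
    refine Subring.sum_mem _ fun i _ => Subring.mul_mem _ (C_mem_regularAt _ _)
      (Subring.sum_mem _ fun j hj => Subring.pow_mem _ (inv_X_add_C_mem_regularAt fun h0 => ?_) _)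
    obtain ⟨hne, hj⟩ := Finset.mem_erase.1 hj
    exact hne (hb j hj 0 (by simpa using h0)).1
  have hpp := principalPart_notMem_regularAt (b j₀) s
    (fun i => v i * ((-1) ^ i * (i.factorial : F))) (by
      simpa using (regularAt _).sub_mem hreg hrest)
  intro i hi
  have h0 : ((-1) ^ i * (i.factorial : F)) ≠ 0 :=
    mul_ne_zero (pow_ne_zero _ (by simp)) (by exact_mod_cast i.factorial_ne_zero)
  rw [hv, (mul_eq_zero.1 (hpp i hi)).resolve_right h0, map_zero]

end RationalFunctions

/-! ### From decay of Mahler coefficients to analyticity -/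

section PadicAnalyticity

open Polynomial

variable {p : ℕ} [hp : Fact p.Prime]

/-- Legendre's formula gives v_p(k!) ≤ k, uniformly in p. This loss of p^k is half of the decay
p^(-2k) assumed below. -/
theorem Padic.norm_inv_factorial_le (k : ℕ) : ‖((k.factorial : ℚ_[p]))⁻¹‖ ≤ (p : ℝ) ^ k := by
  have hp1 : (1 : ℝ) ≤ p := by exact_mod_cast hp.out.one_lt.le
  have hv : padicValNat p k.factorial ≤ k := by
    have h := sub_one_mul_padicValNat_factorial (p := p) k
    have h2 : 1 ≤ p - 1 := by have := hp.out.two_le; omega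
    calc padicValNat p k.factorial ≤ (p - 1) * padicValNat p k.factorial :=
          Nat.le_mul_of_pos_left _ h2
      _ ≤ k := by rw [h]; exact Nat.sub_le _ _
  have h0 : (k.factorial : ℚ_[p]) ≠ 0 := by exact_mod_cast k.factorial_ne_zero
  rw [norm_inv, Padic.norm_eq_zpow_neg_valuation h0, Padic.valuation_natCast, ← zpow_neg, neg_neg,
    zpow_natCast]
  exact pow_le_pow_right₀ hp1 hv

/-- The power series expansion of a `p`-adic function with rapidly decreasing Mahler
coefficients. -/
theorem PadicInt.exists_hasSum_pow_of_norm_fwdDiff_le (f : C(ℤ_[p], ℤ_[p]))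
    (hf : ∀ k, ‖(fwdDiff 1)^[k] f 0‖ ≤ ((p : ℝ)⁻¹ ^ 2) ^ k) :
    ∃ (c : ℕ → ℚ_[p]) (ρ M : ℝ), 0 < ρ ∧ ρ < 1 ∧ (∀ n, ‖c n‖ ≤ M * ρ ^ n) ∧
      ∀ y : ℤ_[p], HasSum (fun n => c n * (y : ℚ_[p]) ^ n) (f y : ℚ_[p]) := by
  have hp0 : (0 : ℝ) < p := by exact_mod_cast hp.out.pos
  have hp1 : (1 : ℝ) < p := by exact_mod_cast hp.out.one_lt
  -- After division by k! a decay p^(-k) = ρ^(2k) remains. As n ≤ k, one ρ^k sums over k and the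
  -- other becomes the bound ρ^n on the n-th power series coefficient.
  set ρ : ℝ := √((p : ℝ)⁻¹) with hρ
  have hρ2 : ρ ^ 2 = (p : ℝ)⁻¹ := Real.sq_sqrt (by positivity)
  have hρ0 : 0 < ρ := Real.sqrt_pos.2 (by positivity)
  have hρ1 : ρ < 1 := by
    rw [hρ, Real.sqrt_lt' one_pos, one_pow]
    exact inv_lt_one_of_one_lt₀ hp1
  set b : ℕ → ℚ_[p] := fun k => (((fwdDiff 1)^[k] f 0 : ℤ_[p]) : ℚ_[p]) * (k.factorial : ℚ_[p])⁻¹ with hb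
  have hbnorm : ∀ k, ‖b k‖ ≤ (ρ ^ 2) ^ k := by
    intro k
    rw [hb, norm_mul, hρ2]
    calc _ ≤ (((p : ℝ)⁻¹ ^ 2) ^ k) * (p : ℝ) ^ k :=
          mul_le_mul (by simpa using hf k) (Padic.norm_inv_factorial_le k) (norm_nonneg _)
            (by positivity)
      _ = _ := by
          rw [← mul_pow]
          congr 1
          field_simp
  set s : ℕ → ℕ → ℚ_[p] := fun k n => ((descPochhammer ℤ k).coeff n : ℚ_[p]) with hs
  have hbs : ∀ k n, ‖b k * s k n‖ ≤ ρ ^ k * ρ ^ n := by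
    intro k n
    rcases lt_or_ge k n with hkn | hkn
    · have : s k n = 0 := by
        rw [hs]
        simp only
        rw [coeff_eq_zero_of_natDegree_lt (by rwa [descPochhammer_natDegree]), Int.cast_zero]
      rw [this, mul_zero, norm_zero]
      positivity
    · rw [norm_mul]
      calc ‖b k‖ * ‖s k n‖ ≤ (ρ ^ 2) ^ k * 1 :=
            mul_le_mul (hbnorm k) (Padic.norm_int_le_one _) (norm_nonneg _) (by positivity)
        _ = ρ ^ k * ρ ^ k := by ring
        _ ≤ ρ ^ k * ρ ^ n :=
            mul_le_mul_of_nonneg_left (pow_le_pow_of_le_one hρ0.le hρ1.le hkn) (by positivity)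
  have hgeom := hasSum_geometric_of_lt_one hρ0.le hρ1
  have hsummable : ∀ n, Summable fun k => b k * s k n := fun n =>
    Summable.of_norm_bounded (hgeom.summable.mul_right (ρ ^ n)) fun k => hbs k n
  refine ⟨fun n => ∑' k, b k * s k n, ρ, (1 - ρ)⁻¹, hρ0, hρ1,
    fun n => tsum_of_norm_bounded (hgeom.mul_right (ρ ^ n)) fun k => hbs k n, fun y => ?_⟩
  have hy : ‖(y : ℚ_[p])‖ ≤ 1 := y.2
  set F : ℕ × ℕ → ℚ_[p] := fun x => b x.1 * s x.1 x.2 * (y : ℚ_[p]) ^ x.2 with hF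
  have hFsum : Summable F := by
    refine Summable.of_norm_bounded (hgeom.summable.mul_of_nonneg hgeom.summable
      (fun _ => by positivity) fun _ => by positivity) fun x => ?_
    rw [hF, norm_mul, norm_pow]
    exact (mul_le_of_le_one_right (norm_nonneg _) (pow_le_one₀ (norm_nonneg _) hy)).trans
      (hbs _ _)
  have hrow : ∀ k, HasSum (fun n => F (k, n)) ((Ring.choose y k * (fwdDiff 1)^[k] f 0 : ℤ_[p]) : ℚ_[p]) := by
    intro k
    have h1 : ((Ring.choose y k * (fwdDiff 1)^[k] f 0 : ℤ_[p]) : ℚ_[p]) =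
        ∑ n ∈ Finset.range (k + 1), F (k, n) := by
      have h2 : (((descPochhammer ℤ k).smeval y : ℤ_[p]) : ℚ_[p]) =
          ∑ n ∈ Finset.range (k + 1), s k n * (y : ℚ_[p]) ^ n := by
        rw [smeval_eq_sum, sum_over_range' _ (by simp [Polynomial.smul_pow]) (k + 1) (by
          rw [descPochhammer_natDegree]; exact k.lt_succ_self)]
        rw [PadicInt.coe_sum]
        refine Finset.sum_congr rfl fun n _ => ?_
        simp [Polynomial.smul_pow, hs]
      rw [Ring.descPochhammer_eq_factorial_smul_choose, nsmul_eq_mul] at h2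
      push_cast at h2
      have h0 : (k.factorial : ℚ_[p]) ≠ 0 := by exact_mod_cast k.factorial_ne_zero
      simp only [hF, mul_assoc]
      rw [← Finset.mul_sum, ← h2, hb]
      push_cast
      field_simp
    rw [h1]
    refine hasSum_sum_of_ne_finset_zero fun n hn => ?_
    have hkn : k < n := by simpa using hn
    have h3 : s k n = 0 := by
      rw [hs]
      simp only
      rw [coeff_eq_zero_of_natDegree_lt (by rwa [descPochhammer_natDegree]), Int.cast_zero]
    simp [hF, h3]
  have hcol : ∀ n, HasSum (fun k => F (k, n)) ((∑' k, b k * s k n) * (y : ℚ_[p]) ^ n) :=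
    fun n => (hsummable n).hasSum.mul_right _
  have hmahler : HasSum (fun k => ((Ring.choose y k * (fwdDiff 1)^[k] f 0 : ℤ_[p]) : ℚ_[p]))
      (f y : ℚ_[p]) := by
    have h1 := (ContinuousMap.hasSum_apply (PadicInt.hasSum_mahler f) y)
    have h2 := h1.map (PadicInt.Coe.ringHom (p := p)) continuous_subtype_val
    simp only [mahlerTerm_apply, mahler_apply, smul_eq_mul] at h2
    exact h2
  have htot := hFsum.hasSum
  -- Summing the double series by rows gives the Mahler series, by columns the power series.
  rw [← (htot.prod_fiberwise hrow).unique hmahler]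
  exact ((Equiv.prodComm ℕ ℕ).hasSum_iff.2 htot).prod_fiberwise hcol

/-- The radius of convergence is at least ρ⁻¹ > 1, so the closed unit ball lies inside the open ball
of convergence. -/
theorem PadicInt.exists_contDiffAt_of_norm_fwdDiff_le (f : C(ℤ_[p], ℤ_[p]))
    (hf : ∀ k, ‖(fwdDiff 1)^[k] f 0‖ ≤ ((p : ℝ)⁻¹ ^ 2) ^ k) :
    ∃ g : ℚ_[p] → ℚ_[p], ∀ y : ℤ_[p], g y = f y ∧ ContDiffAt ℚ_[p] ∞ g y := by
  obtain ⟨c, ρ, M, hρ0, hρ1, hc, hsum⟩ := PadicInt.exists_hasSum_pow_of_norm_fwdDiff_le f hf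
  set S := FormalMultilinearSeries.ofScalars ℚ_[p] c with hS
  lift ρ to NNReal using hρ0.le
  have hρ0' : ρ ≠ 0 := by
    rintro rfl
    exact lt_irrefl _ hρ0
  have hrad : ((ρ⁻¹ : NNReal) : ENNReal) ≤ S.radius := by
    refine S.le_radius_of_bound M fun n => ?_
    rw [hS, FormalMultilinearSeries.ofScalars_norm]
    refine (mul_le_mul_of_nonneg_right (hc n) (by positivity)).trans (le_of_eq ?_)
    rw [mul_assoc, ← mul_pow, NNReal.coe_inv, mul_inv_cancel₀ hρ0.ne', one_pow, mul_one]
  have hrad1 : 1 < S.radius := by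
    refine lt_of_lt_of_le ?_ hrad
    rw [ENNReal.one_lt_coe_iff, one_lt_inv₀ hρ0'.bot_lt]
    exact_mod_cast hρ1
  have hball := S.hasFPowerSeriesOnBall (zero_lt_one.trans hrad1)
  refine ⟨S.sum, fun y => ⟨?_, ?_⟩⟩
  · have h1 := (hsum y).tsum_eq
    rw [← h1]
    exact FormalMultilinearSeries.ofScalars_sum_eq c (y : ℚ_[p])
  · refine (hball.analyticAt_of_mem ?_).contDiffAt
    rw [Metric.mem_eball, edist_zero_right]
    refine lt_of_le_of_lt ?_ hrad1
    rw [enorm_eq_nnnorm, ← ENNReal.coe_one, ENNReal.coe_le_coe]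
    exact y.2

end PadicAnalyticity

/-! ### Functional equation and smoothness of Γ_p -/

section MoritaGamma

open Polynomial

/-- The polynomial `T` with `Γ_p(x + N) = T(x) Γ_p(x)` for all `x` in `pℤ_p`. -/
def moritaStep (p N : ℕ) : ℤ[X] := ∏ j ∈ Finset.range N, if p ∣ j then -1 else -(X + C (j : ℤ))

theorem eval_moritaStep_zero (p N : ℕ) : (moritaStep p N).eval 0 = moritaSeq p N := by
  rw [moritaSeq_eq_prod, moritaStep, eval_prod]
  refine Finset.prod_congr rfl fun j _ => ?_
  unfold moritaFactor
  split_ifs <;> simp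

theorem moritaSeq_mul_add (p m N : ℕ) :
    moritaSeq p (p * m + N) = moritaSeq p (p * m) * (moritaStep p N).eval ((p * m : ℕ) : ℤ) := by
  rw [moritaSeq_eq_prod, Finset.prod_range_add, ← moritaSeq_eq_prod, moritaStep, eval_prod]
  congr 1
  refine Finset.prod_congr rfl fun j _ => ?_
  unfold moritaFactor
  simp only [Nat.dvd_add_right (dvd_mul_right p m)]
  split_ifs <;> simp

variable {p : ℕ} [hp : Fact p.Prime]

theorem moritaGamma_natCast_eq (n : ℕ) (hn : 2 ≤ n) :
    moritaGamma p (n : ℤ_[p]) = (moritaSeq p n : ℤ_[p]) :=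
  (existsUnique_moritaGamma p).choose_spec.1 n hn

/-- The offset 2 keeps to the integers where the defining property of Γ_p prescribes its value. -/
theorem denseRange_natCast_add_two : DenseRange fun n : ℕ => (n : ℤ_[p]) + 2 :=
  (Homeomorph.addRight (2 : ℤ_[p])).surjective.denseRange.comp PadicInt.denseRange_natCast
    (Homeomorph.addRight (2 : ℤ_[p])).continuous

/-- Whether p divides p x + j depends on j only, so on integers the ratio is one fixed polynomial;
continuity and density do the rest. -/
theorem moritaGamma_mul_add (N : ℕ) (x : ℤ_[p]) :
    moritaGamma p (p * x + N) = aeval ((p : ℤ_[p]) * x) (moritaStep p N) * moritaGamma p (p * x) := by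
  refine congrFun (denseRange_natCast_add_two.equalizer
    (g := fun x : ℤ_[p] => moritaGamma p (p * x + N))
    (h := fun x : ℤ_[p] => aeval ((p : ℤ_[p]) * x) (moritaStep p N) * moritaGamma p (p * x))
    (by fun_prop) (((Polynomial.continuous_aeval _).comp (by fun_prop)).mul (by fun_prop))
    (funext fun n => ?_)) x
  have h2 : 2 ≤ p * (n + 2) := hp.out.two_le.trans (Nat.le_mul_of_pos_right _ (by omega))
  have e1 : (p : ℤ_[p]) * (n + 2) = ((p * (n + 2) : ℕ) : ℤ_[p]) := by push_cast; ring
  simp only [Function.comp_apply, e1]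
  rw [← Nat.cast_add, moritaGamma_natCast_eq _ (by omega), moritaGamma_natCast_eq _ h2,
    moritaSeq_mul_add, Int.cast_mul, mul_comm]
  congr 1
  rw [← Int.cast_natCast (R := ℤ_[p]), ← eq_intCast (algebraMap ℤ ℤ_[p]) ((p * (n + 2) : ℕ) : ℤ),
    aeval_algebraMap_apply, eq_intCast]
  simp

theorem moritaGamma_natCast_ne_zero (n : ℕ) (hn : 2 ≤ n) :
    moritaGamma p (n : ℤ_[p]) ≠ 0 := by
  rw [moritaGamma_natCast_eq n hn, moritaSeq_eq_prod]
  rw [Int.cast_ne_zero, Finset.prod_ne_zero_iff]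
  intro j _
  unfold moritaFactor
  split_ifs with h
  · simp
  · rw [neg_ne_zero]
    rintro h0
    rw [Nat.cast_eq_zero.1 h0] at h
    exact h (dvd_zero p)

theorem C_dvd_comp_sub {R : Type*} [CommRing R] (a : R) (f : R[X]) :
    C a ∣ f.comp (X + C a) - f := by
  have h := sub_dvd_eval_sub (X + C a) X (f.map C)
  rwa [add_sub_cancel_left, eval_map, eval_map, ← comp, eval₂_C_X] at h

/-- In the variable w = p^2 x the step x ↦ x + 1 is w ↦ w + p^2, which changes R(w) by a multiple of
p^2, and Γ_p(p^4 x) is multiplied by T(w) with T ≡ 1 mod p^2. Every difference therefore gains a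
factor p^2. -/
theorem exists_fwdDiff_iter_moritaGamma (k : ℕ) : ∃ R : ℤ[X], ∀ x : ℤ_[p],
    (fwdDiff 1)^[k] (fun y : ℤ_[p] => moritaGamma p (p ^ 4 * y)) x =
      (p : ℤ_[p]) ^ (2 * k) * aeval ((p : ℤ_[p]) ^ 2 * x) R * moritaGamma p (p ^ 4 * x) := by
  induction k with
  | zero => exact ⟨1, fun x => by simp⟩
  | succ k ih =>
    obtain ⟨R, hR⟩ := ih
    set a : ℤ := (p : ℤ) ^ 2 with ha
    set T : ℤ[X] := (moritaStep p (p ^ 4)).comp (C a * X) with hT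
    have hT1 : C a ∣ T - 1 := by
      have h1 : C a * X ∣ T - C (moritaSeq p (p ^ 4)) := by
        have := sub_dvd_eval_sub (C a * X) 0 ((moritaStep p (p ^ 4)).map C)
        rw [sub_zero, eval_map, ← comp, ← C_0, eval_map, eval₂_at_apply,
          eval_moritaStep_zero] at this
        exact this
      have h2 : C a ∣ C (moritaSeq p (p ^ 4)) - 1 := by
        rw [← C_1, ← C_sub]
        -- The congruence for the value at p^4 is available mod p^3; p^2 suffices.
        refine _root_.map_dvd C ((pow_dvd_pow (p : ℤ) (by norm_num : 2 ≤ 3)).trans ?_)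
        exact (moritaSeq_prime_pow p 3).symm.dvd
      have := dvd_add ((dvd_mul_right (C a) X).trans h1) h2
      rwa [sub_add_sub_cancel] at this
    obtain ⟨S, hS⟩ : C a ∣ R.comp (X + C a) * T - R := by
      have : R.comp (X + C a) * T - R = (R.comp (X + C a) - R) * T + R * (T - 1) := by ring
      rw [this]
      exact dvd_add ((C_dvd_comp_sub a R).mul_right T) (hT1.mul_left R)
    refine ⟨S, fun x => ?_⟩
    have hstep : moritaGamma p (p ^ 4 * (x + 1)) =
        aeval ((p : ℤ_[p]) ^ 2 * x) T * moritaGamma p (p ^ 4 * x) := by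
      have h := moritaGamma_mul_add (p := p) (p ^ 4) (p ^ 3 * x)
      have e1 : (p : ℤ_[p]) * (p ^ 3 * x) = p ^ 4 * x := by ring
      rw [e1] at h
      rw [Nat.cast_pow] at h
      rw [mul_add, mul_one, h, hT, aeval_comp]
      congr 2
      simp [ha]
      ring_nf
    have hRS := congrArg (aeval ((p : ℤ_[p]) ^ 2 * x)) hS
    rw [map_sub, map_mul, aeval_comp, map_mul, aeval_C] at hRS
    have e2 : aeval ((p : ℤ_[p]) ^ 2 * x) (X + C a) = (p : ℤ_[p]) ^ 2 * (x + 1) := by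
      simp [ha]
      ring
    have e3 : algebraMap ℤ ℤ_[p] a = (p : ℤ_[p]) ^ 2 := by simp [ha]
    rw [e2, e3] at hRS
    rw [Function.iterate_succ_apply', fwdDiff, hR, hR, hstep]
    linear_combination (p : ℤ_[p]) ^ (2 * k) * moritaGamma p (p ^ 4 * x) * hRS

theorem exists_contDiffAt_moritaGamma : ∃ g : ℚ_[p] → ℚ_[p], ∀ y : ℤ_[p],
    g y = moritaGamma p (p ^ 4 * y) ∧ ContDiffAt ℚ_[p] ∞ g y := by
  refine PadicInt.exists_contDiffAt_of_norm_fwdDiff_le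
    ((moritaGamma p).comp ⟨fun y => (p : ℤ_[p]) ^ 4 * y, by fun_prop⟩) fun k => ?_
  obtain ⟨R, hR⟩ := exists_fwdDiff_iter_moritaGamma (p := p) k
  change ‖(fwdDiff 1)^[k] (fun y : ℤ_[p] => moritaGamma p (p ^ 4 * y)) 0‖ ≤ _
  rw [hR, norm_mul, norm_mul, norm_pow, PadicInt.norm_p, pow_mul, mul_assoc]
  exact mul_le_of_le_one_right (by positivity)
    (mul_le_one₀ (PadicInt.norm_le_one _) (norm_nonneg _) (PadicInt.norm_le_one _))

theorem zeroExtend_coe (f : ℤ_[p] → ℂ_[p]) (x : ℤ_[p]) : zeroExtend f (x : ℚ_[p]) = f x :=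
  Subtype.val_injective.extend_apply _ _ _

/-- Near a point of a + p^4 ℤ_p, a natural, Γ_p(w) is a polynomial in w - a times Γ_p(w - a), and
the latter is smooth by the case of p^4 ℤ_p. Off ℤ_p the extension is locally zero. -/
theorem isSmoothOnPadicInt_moritaGammaC : IsSmoothOnPadicInt (moritaGammaC p) := by
  have hp0 : (p : ℚ_[p]) ≠ 0 := by exact_mod_cast hp.out.ne_zero
  rw [IsSmoothOnPadicInt, contDiff_iff_contDiffAt]
  intro z
  have hopen : IsOpen {z : ℚ_[p] | ‖z‖ ≤ 1} := by
    have := IsUltrametricDist.isOpen_closedBall (0 : ℚ_[p]) one_ne_zero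
    simpa [Metric.closedBall, dist_zero_right] using this
  by_cases hz : ‖z‖ ≤ 1
  · obtain ⟨g, hg⟩ := exists_contDiffAt_moritaGamma (p := p)
    set z' : ℤ_[p] := ⟨z, hz⟩ with hz'
    have hzz' : (z' : ℚ_[p]) = z := rfl
    obtain ⟨a, ha⟩ : ∃ a : ℕ, z' - (a : ℤ_[p]) ∈ Ideal.span {(p : ℤ_[p]) ^ 4} :=
      ⟨_, PadicInt.appr_spec 4 z'⟩
    obtain ⟨y, hy⟩ := Ideal.mem_span_singleton.1 ha
    have hzy : z = a + p ^ 4 * y := by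
      have := congrArg (fun x : ℤ_[p] => (x : ℚ_[p])) hy
      simp only [PadicInt.coe_sub, PadicInt.coe_natCast, PadicInt.coe_mul, PadicInt.coe_pow,
        hzz'] at this
      linear_combination this
    set h : ℚ_[p] → ℚ_[p] := fun w => aeval (w - a) (moritaStep p a) * g ((w - a) / p ^ 4) with hh
    have hyz : (z - a) / p ^ 4 = y := by
      rw [hzy]
      field_simp
      ring
    have hcont : ContDiffAt ℚ_[p] ∞ h z := by
      refine ContDiffAt.mul ?_ ?_
      · exact (((moritaStep p a).contDiff_aeval ∞).comp
          (contDiff_id.sub contDiff_const)).contDiffAt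
      · refine ContDiffAt.comp z ?_ (by fun_prop)
        rw [hyz]
        exact (hg y).2
    have heq : zeroExtend (moritaGammaC p) =ᶠ[𝓝 z] fun w => algebraMap ℚ_[p] ℂ_[p] (h w) := by
      have hopen' : IsOpen {w : ℚ_[p] | ‖(w - a) / p ^ 4‖ ≤ 1} :=
        hopen.preimage (f := fun w : ℚ_[p] => (w - a) / p ^ 4) (by fun_prop)
      filter_upwards [hopen'.mem_nhds (by
        change ‖(z - a) / p ^ 4‖ ≤ 1
        rw [hyz]
        exact y.2)] with w hw
      set v : ℤ_[p] := ⟨(w - a) / p ^ 4, hw⟩ with hv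
      have hwv : w = ((p * (p ^ 3 * v) + a : ℤ_[p]) : ℚ_[p]) := by
        push_cast
        rw [hv]
        field_simp
        ring
      conv_lhs => rw [hwv]
      rw [zeroExtend_coe, moritaGammaC, moritaGamma_mul_add, hh]
      congr 1
      have e1 : (p : ℤ_[p]) * (p ^ 3 * v) = p ^ 4 * v := by ring
      have e2 : w - a = algebraMap ℤ_[p] ℚ_[p] (p ^ 4 * v) := by
        rw [hwv, e1]
        simp
      rw [e1]
      change _ = aeval (w - a) (moritaStep p a) * g v
      rw [PadicInt.coe_mul, ← (hg v).1, e2, aeval_algebraMap_apply]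
      rfl
    refine ContDiffAt.congr_of_eventuallyEq ?_ heq
    exact (algebraMapCLM ℚ_[p] ℂ_[p]).contDiff.contDiffAt.comp z hcont
  · have hclosed : IsOpen {w : ℚ_[p] | ‖w‖ ≤ 1}ᶜ :=
      (isClosed_le continuous_norm continuous_const).isOpen_compl
    have heq : zeroExtend (moritaGammaC p) =ᶠ[𝓝 z] fun _ => 0 := by
      filter_upwards [hclosed.mem_nhds hz] with w hw
      refine Function.extend_apply' _ _ _ ?_
      rintro ⟨v, rfl⟩
      exact hw v.2
    exact contDiffAt_const.congr_of_eventuallyEq heq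

end MoritaGamma

/-! ### Rational functions as germs of sequences -/

section GermsOfSequences

open Filter

variable {F : Type*} [Field F]

theorem eventually_eval_ne_zero {x : ℕ → F} (hx : Function.Injective x) {b : Polynomial F}
    (hb : b ≠ 0) : ∀ᶠ n in atTop, b.eval (x n) ≠ 0 := by
  rw [← Nat.cofinite_eq_atTop]
  refine ((b.rootSet_finite F).preimage (f := x) hx.injOn).subset fun n hn => ?_
  have : b.eval (x n) = 0 := by simpa using hn
  rw [Set.mem_preimage, Polynomial.mem_rootSet]
  exact ⟨hb, by simpa using this⟩

/-- The evaluation of polynomials along a sequence. -/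
def polyGerm (x : ℕ → F) : Polynomial F →+* (atTop : Filter ℕ).Germ F :=
  (Germ.coeRingHom atTop).comp (RingHom.pi fun n => Polynomial.evalRingHom (x n))

theorem isUnit_germ {f : ℕ → F} (hf : ∀ᶠ n in atTop, f n ≠ 0) :
    IsUnit (f : (atTop : Filter ℕ).Germ F) := by
  refine IsUnit.of_mul_eq_one ((fun n => (f n)⁻¹ : ℕ → F) : (atTop : Filter ℕ).Germ F) ?_
  rw [← Germ.coe_mul, ← Germ.coe_one, Germ.coe_eq]
  filter_upwards [hf] with n hn using mul_inv_cancel₀ hn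

/-- The evaluation of rational functions along an injective sequence. -/
def ratGerm {x : ℕ → F} (hx : Function.Injective x) :
    RatFunc F →+* (atTop : Filter ℕ).Germ F :=
  IsLocalization.lift (M := nonZeroDivisors (Polynomial F)) (g := polyGerm x) fun b =>
    isUnit_germ (eventually_eval_ne_zero hx (nonZeroDivisors.ne_zero b.2))

theorem ratGerm_algebraMap {x : ℕ → F} (hx : Function.Injective x) (b : Polynomial F) :
    ratGerm hx (algebraMap _ _ b) = ((fun n => b.eval (x n) : ℕ → F) : (atTop : Filter ℕ).Germ F) :=
  IsLocalization.lift_eq _ b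

/-- An injective sequence meets the poles of `r` only finitely often, so the default values of
`RatFunc.eval` there do not affect the germ. -/
theorem ratGerm_apply {x : ℕ → F} (hx : Function.Injective x) (r : RatFunc F) :
    ratGerm hx r =
      ((fun n => r.eval (RingHom.id F) (x n) : ℕ → F) : (atTop : Filter ℕ).Germ F) := by
  have hu := isUnit_germ (eventually_eval_ne_zero hx r.denom_ne_zero)
  refine hu.mul_right_cancel ?_
  rw [← ratGerm_algebraMap hx, ← map_mul]
  nth_rw 1 [← RatFunc.num_div_denom r]
  rw [div_mul_cancel₀ _ (RatFunc.algebraMap_ne_zero r.denom_ne_zero), ratGerm_algebraMap,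
    ratGerm_algebraMap, ← Germ.coe_mul, Germ.coe_eq]
  filter_upwards [eventually_eval_ne_zero hx r.denom_ne_zero] with n hn
  simp only [Pi.mul_apply, RatFunc.eval, Polynomial.eval₂_id]
  rw [div_mul_cancel₀ _ hn]

theorem ratGerm_C {x : ℕ → F} (hx : Function.Injective x) (a : F) :
    ratGerm hx (RatFunc.C a) = ((fun _ => a : ℕ → F) : (atTop : Filter ℕ).Germ F) := by
  rw [ratGerm_apply]
  simp

/-- The shift of germs of sequences. -/
def shiftGerm (F : Type*) [Field F] :
    (atTop : Filter ℕ).Germ F →+* (atTop : Filter ℕ).Germ F where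
  toFun f := f.compTendsto (· + 1) (tendsto_add_atTop_nat 1)
  map_one' := rfl
  map_zero' := rfl
  map_mul' f g := Germ.inductionOn₂ f g fun _ _ => rfl
  map_add' f g := Germ.inductionOn₂ f g fun _ _ => rfl

theorem shiftGerm_coe (f : ℕ → F) : shiftGerm F (f : (atTop : Filter ℕ).Germ F) =
    ((fun n => f (n + 1) : ℕ → F) : (atTop : Filter ℕ).Germ F) := rfl

theorem shiftGerm_ratGerm {x : ℕ → F} (hx : Function.Injective x) {c : F}
    (hc : ∀ n, x (n + 1) = x n + c) (r : RatFunc F) :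
    shiftGerm F (ratGerm hx r) = ratGerm hx (ratShift c r) := by
  have : (shiftGerm F).comp (ratGerm hx) = (ratGerm hx).comp (ratShift c) := by
    refine IsLocalization.ringHom_ext (nonZeroDivisors (Polynomial F)) (RingHom.ext fun b => ?_)
    simp only [RingHom.comp_apply, ratShift_algebraMap, ratGerm_algebraMap, shiftGerm_coe,
      Polynomial.taylor_eval, hc]
  exact RingHom.congr_fun this r

end GermsOfSequences

/-! ### Hölder's argument along a sequence of points -/

section JetSequences

open Filter MvPolynomial

variable {F : Type*} [Field F]

/-- This intertwining makes the ideal of relations stable under the substitution: the shift of a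
zero germ is zero. -/
theorem shiftGerm_eval₂Hom {x : ℕ → F} (hx : Function.Injective x) {c : F}
    (hc : ∀ n, x (n + 1) = x n + c) {Q : RatFunc F} {q : ℕ → RatFunc F}
    {v : Option ℕ → (atTop : Filter ℕ).Germ F} (hZ : shiftGerm F (v none) = ratGerm hx Q * v none)
    (hY : ∀ i, shiftGerm F (v (some i)) = v (some i) + ratGerm hx (q i))
    (P : MvPolynomial (Option ℕ) (RatFunc F)) :
    eval₂Hom (ratGerm hx) v (shiftSubst (ratShift c) Q q P) =
      shiftGerm F (eval₂Hom (ratGerm hx) v P) := by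
  have : (eval₂Hom (ratGerm hx) v).comp (shiftSubst (ratShift c) Q q) =
      (shiftGerm F).comp (eval₂Hom (ratGerm hx) v) := by
    refine MvPolynomial.ringHom_ext (fun r => ?_) fun o => ?_
    · simp [shiftGerm_ratGerm hx hc]
    · rcases o with - | i
      · simp [hZ]
      · simp [hY]
  exact RingHom.congr_fun this P

theorem eval₂Hom_logJetSubst [CharZero F] {x : ℕ → F} (hx : Function.Injective x)
    {y : ℕ → ℕ → F} (hy : ∀ n, y n 0 ≠ 0) (P : MvPolynomial ℕ (RatFunc F)) :
    eval₂Hom (ratGerm hx) (fun o : Option ℕ => ((fun n => o.elim (y n 0) (logDerivJet (y n)) :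
      ℕ → F) : (atTop : Filter ℕ).Germ F)) (logJetSubst (RatFunc F) P) =
    eval₂Hom (ratGerm hx) (fun k => ((fun n => y n k : ℕ → F) : (atTop : Filter ℕ).Germ F)) P := by
  set V : Option ℕ → ℕ → F := fun o n => o.elim (y n 0) (logDerivJet (y n)) with hV
  have : (eval₂Hom (ratGerm hx) fun o : Option ℕ => ((V o : ℕ → F) : (atTop : Filter ℕ).Germ F)).comp
      (logJetSubst (RatFunc F)).toRingHom =
      eval₂Hom (ratGerm hx) fun k => ((fun n => y n k : ℕ → F) : (atTop : Filter ℕ).Germ F) := by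
    refine MvPolynomial.ringHom_ext (fun r => ?_) fun k => ?_
    · simp [logJetSubst]
    · have h1 : aeval V (logJet k) = fun n => y n k := by
        funext n
        have h2 := map_aeval V (Pi.evalRingHom (fun _ : ℕ => F) n) (logJet k)
        rw [Pi.evalRingHom_apply] at h2
        rw [h2, ← aeval_logJet (hy n) k, aeval_def, coe_eval₂Hom]
        congr 1
      have h3 := map_aeval V (Germ.coeRingHom (atTop : Filter ℕ)) (logJet k)
      rw [h1] at h3
      simp only [RingHom.comp_apply, AlgHom.toRingHom_eq_coe, RingHom.coe_coe, logJetSubst, aeval_X,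
        coe_eval₂Hom, eval₂_map, eval₂_X]
      refine Eq.trans ?_ h3.symm
      rw [coe_eval₂Hom]
      congr 1
      exact Subsingleton.elim _ _
  exact RingHom.congr_fun this P

/-- Hölder's theorem along a sequence: the jets of a function with `f(x + c) = Q(x) f(x)` satisfy
no nontrivial differential polynomial, when `Q` is a product of linear factors whose roots are
pairwise inequivalent modulo `c`. -/
theorem not_eventually_eval_jet_eq_zero [CharZero F] {x : ℕ → F} {c : F} (hc0 : c ≠ 0)
    (hx : Function.Injective x) (hc : ∀ n, x (n + 1) = x n + c) {t : Finset ℕ} {b : ℕ → F}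
    {e : F} (he : e ≠ 0) {j₀ : ℕ} (hj₀ : j₀ ∈ t)
    (hb : ∀ j ∈ t, ∀ k : ℤ, -b j₀ + k * c + b j = 0 → j = j₀ ∧ k = 0)
    (hxb : ∀ n, ∀ j ∈ t, x n + b j ≠ 0) {y : ℕ → ℕ → F} (hy : ∀ n, y n 0 ≠ 0)
    (hjet : ∀ n, powerSeriesOfJet (y (n + 1)) =
      PowerSeries.C e * (∏ j ∈ t, (PowerSeries.X + PowerSeries.C (x n + b j))) *
        powerSeriesOfJet (y n))
    {P : MvPolynomial ℕ (RatFunc F)} (hP : P ≠ 0) :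
    ¬ ∀ᶠ n in atTop, ∑ m ∈ P.support,
      (P.coeff m).eval (RingHom.id F) (x n) * m.prod (fun k d => y n k ^ d) = 0 := by
  classical
  intro hvan
  set Q : RatFunc F := algebraMap (Polynomial F) (RatFunc F)
    (Polynomial.C e * ∏ j ∈ t, (Polynomial.X + Polynomial.C (b j))) with hQ
  set q : ℕ → RatFunc F := fun i => RatFunc.C ((-1) ^ i * (i.factorial : F)) *
      ∑ j ∈ t, (RatFunc.X + RatFunc.C (b j))⁻¹ ^ (i + 1) with hq
  set v : Option ℕ → (atTop : Filter ℕ).Germ F := fun o =>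
    ((fun n => o.elim (y n 0) (logDerivJet (y n)) : ℕ → F) : (atTop : Filter ℕ).Germ F) with hv
  have hQdeg : Q.intDegree ≠ 0 := by
    rw [hQ, RatFunc.intDegree_polynomial, Polynomial.natDegree_C_mul he,
      Polynomial.natDegree_prod_of_monic _ _ fun j _ => Polynomial.monic_X_add_C _]
    simpa using Finset.ne_empty_of_mem hj₀
  have hQ0 : Q ≠ 0 := by
    intro h
    simp [h] at hQdeg
  have hZ : shiftGerm F (v none) = ratGerm hx Q * v none := by
    rw [hQ, ratGerm_algebraMap, hv]
    simp only [Option.elim_none]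
    rw [shiftGerm_coe, ← Germ.coe_mul]
    congr 1
    funext n
    have h1 := congrArg PowerSeries.constantCoeff (hjet n)
    simpa [powerSeriesOfJet, Polynomial.eval_prod] using h1
  have hY : ∀ i, shiftGerm F (v (some i)) = v (some i) + ratGerm hx (q i) := by
    intro i
    have hXinv : ∀ j ∈ t, ratGerm hx (RatFunc.X + RatFunc.C (b j))⁻¹ =
        ((fun n => (x n + b j)⁻¹ : ℕ → F) : (atTop : Filter ℕ).Germ F) := by
      intro j hj
      have h1 : ratGerm hx (RatFunc.X + RatFunc.C (b j)) =
          ((fun n => x n + b j : ℕ → F) : (atTop : Filter ℕ).Germ F) := by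
        rw [← RatFunc.algebraMap_X, ← RatFunc.algebraMap_C, ← map_add, ratGerm_algebraMap]
        simp
      have hu := isUnit_germ (Eventually.of_forall fun n => hxb n j hj)
      refine hu.mul_right_cancel ?_
      rw [← h1, ← map_mul, inv_mul_cancel₀ (X_add_C_ne_zero' (b j)), h1, map_one, ← Germ.coe_mul]
      refine congrArg _ (funext fun n => ?_)
      exact (inv_mul_cancel₀ (hxb n j hj)).symm
    have hqi : ratGerm hx (q i) = ((fun n => (-1) ^ i * (i.factorial : F) *
        ∑ j ∈ t, (x n + b j)⁻¹ ^ (i + 1) : ℕ → F) : (atTop : Filter ℕ).Germ F) := by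
      have hsum : ∑ j ∈ t, ratGerm hx ((RatFunc.X + RatFunc.C (b j))⁻¹ ^ (i + 1)) =
          Germ.coeRingHom (atTop : Filter ℕ) (∑ j ∈ t, fun n => (x n + b j)⁻¹ ^ (i + 1)) := by
        rw [map_sum]
        refine Finset.sum_congr rfl fun j hj => ?_
        rw [map_pow, hXinv j hj]
        rfl
      rw [hq, map_mul, map_sum, ratGerm_C, hsum, Germ.coe_coeRingHom, ← Germ.coe_mul]
      refine congrArg _ (funext fun n => ?_)
      simp
    rw [hqi, hv]
    simp only [Option.elim_some]
    rw [shiftGerm_coe, ← Germ.coe_add]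
    refine congrArg _ (funext fun n => ?_)
    exact logDerivJet_of_eq_mul t e he (fun j => x n + b j) (hxb n) (hy n) (hjet n) i
  set I := RingHom.ker (eval₂Hom (ratGerm hx) v) with hI
  have hIstable : ∀ R ∈ I, affineSubst (ratShift c) (fun o => o.elim Q fun _ => 1)
      (fun o => o.elim 0 q) R ∈ I := by
    intro R hR
    rw [hI, RingHom.mem_ker] at hR ⊢
    rw [shiftGerm_eval₂Hom hx hc hZ hY, hR, map_zero]
  have hPI : logJetSubst (RatFunc F) P ∈ I := by
    rw [hI, RingHom.mem_ker, hv, eval₂Hom_logJetSubst hx hy, coe_eval₂Hom, eval₂_eq]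
    have h1 : ∑ m ∈ P.support, ratGerm hx (coeff m P) *
        ∏ k ∈ m.support, ((fun n => y n k : ℕ → F) : (atTop : Filter ℕ).Germ F) ^ m k =
        Germ.coeRingHom (atTop : Filter ℕ) (∑ m ∈ P.support,
          (fun n => (coeff m P).eval (RingHom.id F) (x n)) *
            ∏ k ∈ m.support, (fun n => y n k) ^ m k) := by
      rw [map_sum]
      refine Finset.sum_congr rfl fun m _ => ?_
      rw [map_mul, map_prod, ratGerm_apply]
      simp only [map_pow]
      rfl
    rw [h1, Germ.coe_coeRingHom, ← Germ.coe_zero, Germ.coe_eq]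
    filter_upwards [hvan] with n hn
    simpa [Finsupp.prod] using hn
  have hIne : I ≠ ⊥ := fun h => logJetSubst_ne_zero hP (by
    rw [h] at hPI
    exact hPI)
  obtain ⟨R, hRI, hR0, d, hR⟩ := exists_semiinvariant _ _ _ I hIstable hIne
  have hd : (d.prod fun o a => (o.elim Q fun _ => 1 : RatFunc F) ^ a) = Q ^ d none := by
    rw [Finsupp.prod_option_index _ _ (by simp) (by intros; exact pow_add _ _ _)]
    simp [Finsupp.prod]
  rw [hd] at hR
  -- The multiplier is a power of Q since every Y_i has linear coefficient 1, so the classification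
  -- applies.
  have hmon := semiinvariant_eq_monomial hQ0 (fun a ha l h => ratShift_mul_pow_eq hQdeg ha h)
    (fun s γ g hγ h => eq_zero_of_sum_eq_ratShift_sub hc0 hj₀ hb s γ g hγ h) hR
  set a := coeff (Finsupp.single none (d none)) R with ha
  have ha0 : a ≠ 0 := by
    intro h
    rw [h, monomial_zero] at hmon
    exact hR0 hmon
  rw [hI, RingHom.mem_ker, hmon, coe_eval₂Hom, eval₂_monomial,
    Finsupp.prod_single_index (h := fun o a => v o ^ a) (pow_zero _)] at hRI
  -- A nonzero rational function and the nowhere vanishing sequence `y n 0` are both units among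
  -- germs, although the ring of germs is not a field.
  have hunit : IsUnit (ratGerm hx a * v none ^ d none) :=
    ((isUnit_iff_ne_zero.2 ha0).map (ratGerm hx)).mul
      ((isUnit_germ (Eventually.of_forall hy)).pow _)
  rw [hRI] at hunit
  exact not_isUnit_zero hunit

end JetSequences

/-! ### Formal Taylor series of smooth functions -/

section Taylor

variable {𝕜 A : Type*} [NontriviallyNormedField 𝕜] [NormedField A] [NormedAlgebra 𝕜 A]

/-- The Taylor series of `f` at `x`. -/
def taylorSeries (f : 𝕜 → A) (x : 𝕜) : PowerSeries A :=
  powerSeriesOfJet fun k => iteratedDeriv k f x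

theorem taylorSeries_mul [CharZero A] {f g : 𝕜 → A} {x : 𝕜} (hf : ContDiffAt 𝕜 ∞ f x)
    (hg : ContDiffAt 𝕜 ∞ g x) :
    taylorSeries (fun z => f z * g z) x = taylorSeries f x * taylorSeries g x := by
  ext n
  simp only [taylorSeries, powerSeriesOfJet, PowerSeries.coeff_mk, PowerSeries.coeff_mul]
  rw [iteratedDeriv_fun_mul (hf.of_le (by exact_mod_cast le_top))
    (hg.of_le (by exact_mod_cast le_top)), Finset.sum_div,
    Finset.Nat.sum_antidiagonal_eq_sum_range_succ_mk]
  refine Finset.sum_congr rfl fun i hi => ?_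
  have hin : i ≤ n := Nat.lt_succ_iff.1 (Finset.mem_range.1 hi)
  have h1 : (n.factorial : A) = n.choose i * i.factorial * (n - i).factorial := by
    exact_mod_cast (Nat.choose_mul_factorial_mul_factorial hin).symm
  have h2 : (n.choose i : A) ≠ 0 := by exact_mod_cast (Nat.choose_pos hin).ne'
  have h3 : (i.factorial : A) ≠ 0 := by exact_mod_cast i.factorial_ne_zero
  have h4 : ((n - i).factorial : A) ≠ 0 := by exact_mod_cast (n - i).factorial_ne_zero
  rw [h1]
  field_simp

theorem taylorSeries_const (a : A) (x : 𝕜) : taylorSeries (fun _ => a) x = PowerSeries.C a := by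
  ext n
  rw [taylorSeries, powerSeriesOfJet, PowerSeries.coeff_mk, PowerSeries.coeff_C,
    iteratedDeriv_const]
  split_ifs with h
  · simp [h]
  · simp

theorem contDiff_algebraMap_add_const (a : A) :
    ContDiff 𝕜 ∞ fun z : 𝕜 => algebraMap 𝕜 A z + a :=
  (algebraMapCLM 𝕜 A).contDiff.add contDiff_const

theorem taylorSeries_algebraMap_add_const (a : A) (x : 𝕜) :
    taylorSeries (fun z : 𝕜 => algebraMap 𝕜 A z + a) x =
      PowerSeries.X + PowerSeries.C (algebraMap 𝕜 A x + a) := by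
  have hderiv : deriv (fun z : 𝕜 => algebraMap 𝕜 A z + a) = fun _ => 1 := by
    funext z
    have h1 : HasDerivAt (fun z : 𝕜 => algebraMap 𝕜 A z) (algebraMap 𝕜 A 1) z :=
      (algebraMapCLM 𝕜 A).hasDerivAt
    rw [map_one] at h1
    exact (h1.add_const a).deriv
  ext n
  rw [taylorSeries, powerSeriesOfJet, PowerSeries.coeff_mk, map_add, PowerSeries.coeff_X,
    PowerSeries.coeff_C]
  rcases n with - | n
  · simp
  · rw [iteratedDeriv_succ', hderiv, iteratedDeriv_const]
    rcases n with - | n <;> simp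

theorem taylorSeries_prod [CharZero A] {α : Type*} (s : Finset α) (f : α → 𝕜 → A) (x : 𝕜)
    (hf : ∀ j ∈ s, ContDiff 𝕜 ∞ (f j)) :
    taylorSeries (fun z => ∏ j ∈ s, f j z) x = ∏ j ∈ s, taylorSeries (f j) x := by
  classical
  induction s using Finset.induction_on with
  | empty => simpa using taylorSeries_const (1 : A) x
  | insert j s hj ih =>
    simp only [Finset.prod_insert hj]
    rw [taylorSeries_mul (hf j (by simp)).contDiffAt
      (ContDiff.contDiffAt (contDiff_prod fun i hi => hf i (by simp [hi]))),
      ih fun i hi => hf i (by simp [hi])]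

end Taylor

/-! ### Differential transcendence of Γ_p -/

section DifferentialTranscendence

open Filter

variable {p : ℕ} [hp : Fact p.Prime]

theorem aeval_moritaStep (p : ℕ) {A : Type*} [CommRing A] [Algebra ℤ A] (z : A) :
    Polynomial.aeval z (moritaStep p p) =
      (-1) ^ p * ∏ j ∈ (Finset.range p).filter (¬ p ∣ ·), (z + j) := by
  have h : ∀ j, (if p ∣ j then -1 else -(Polynomial.X + Polynomial.C (j : ℤ)) : Polynomial ℤ) =
      (-1) * if ¬ p ∣ j then Polynomial.X + Polynomial.C (j : ℤ) else 1 := by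
    intro j
    split_ifs <;> simp_all
  rw [moritaStep]
  simp only [h, Finset.prod_mul_distrib, Finset.prod_const, Finset.card_range, ← Finset.prod_filter]
  simp [map_prod]

/-- The functional equation of `Γ_p` as a relation between Taylor series. -/
theorem taylorSeries_moritaGammaC_add (x : ℤ_[p]) :
    taylorSeries (zeroExtend (moritaGammaC p)) ((p * x + p : ℤ_[p]) : ℚ_[p]) =
      PowerSeries.C ((-1) ^ p) * (∏ j ∈ (Finset.range p).filter (¬ p ∣ ·),
        (PowerSeries.X + PowerSeries.C (algebraMap ℚ_[p] ℂ_[p] ((p * x : ℤ_[p]) : ℚ_[p]) + (j : ℂ_[p])))) *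
      taylorSeries (zeroExtend (moritaGammaC p)) ((p * x : ℤ_[p]) : ℚ_[p]) := by
  set G := zeroExtend (moritaGammaC p) with hG
  set z₀ : ℚ_[p] := ((p * x : ℤ_[p]) : ℚ_[p]) with hz₀
  have hp0 : (p : ℚ_[p]) ≠ 0 := by exact_mod_cast hp.out.ne_zero
  have hsmooth : ContDiff ℚ_[p] ∞ G := isSmoothOnPadicInt_moritaGammaC
  -- The equation holds on all of pℤ_p, an open neighbourhood of `z₀`, so all derivatives at `z₀`
  -- may be compared.
  have hfe : (fun z => G (z + p)) =ᶠ[𝓝 z₀] fun z => ((-1) ^ p *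
      ∏ j ∈ (Finset.range p).filter (¬ p ∣ ·), (algebraMap ℚ_[p] ℂ_[p] z + (j : ℂ_[p]))) * G z := by
    have hopen : IsOpen {z : ℚ_[p] | ‖z / p‖ ≤ 1} := by
      have h1 := IsUltrametricDist.isOpen_closedBall (0 : ℚ_[p]) one_ne_zero
      have h2 : IsOpen {z : ℚ_[p] | ‖z‖ ≤ 1} := by
        simpa [Metric.closedBall, dist_zero_right] using h1
      exact h2.preimage (f := fun z : ℚ_[p] => z / p) (by fun_prop)
    have hmem : ‖z₀ / p‖ ≤ 1 := by
      rw [hz₀, PadicInt.coe_mul, PadicInt.coe_natCast, mul_div_cancel_left₀ _ hp0]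
      exact x.2
    filter_upwards [hopen.mem_nhds hmem] with z hz
    set w : ℤ_[p] := ⟨z / p, hz⟩ with hw
    have hwz : z = ((p * w : ℤ_[p]) : ℚ_[p]) := by
      rw [PadicInt.coe_mul, PadicInt.coe_natCast, hw]
      field_simp
    have hwz' : z + p = ((p * w + p : ℤ_[p]) : ℚ_[p]) := by
      rw [PadicInt.coe_add, ← hwz, PadicInt.coe_natCast]
    have hcast : algebraMap ℚ_[p] ℂ_[p] ((Polynomial.aeval ((p : ℤ_[p]) * w) (moritaStep p p) :
        ℤ_[p]) : ℚ_[p]) = Polynomial.aeval (algebraMap ℚ_[p] ℂ_[p] z) (moritaStep p p) := by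
      rw [Polynomial.aeval_algebraMap_apply, hwz]
      congr 1
      exact (Polynomial.aeval_algebraMap_apply ℚ_[p] ((p : ℤ_[p]) * w) (moritaStep p p)).symm
    rw [aeval_moritaStep p (algebraMap ℚ_[p] ℂ_[p] z)] at hcast
    rw [← hcast, hwz', hG, zeroExtend_coe, moritaGammaC, moritaGamma_mul_add,
      PadicInt.coe_mul, map_mul, hwz, zeroExtend_coe, moritaGammaC]
  have hprod : ContDiff ℚ_[p] ∞ fun z => ∏ j ∈ (Finset.range p).filter (¬ p ∣ ·),
      (algebraMap ℚ_[p] ℂ_[p] z + (j : ℂ_[p])) :=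
    contDiff_prod fun j _ => contDiff_algebraMap_add_const _
  have h1 : taylorSeries G (z₀ + p) = taylorSeries (fun z => G (z + p)) z₀ := by
    simp only [taylorSeries, iteratedDeriv_comp_add_const]
  have h2 : taylorSeries (fun z => G (z + p)) z₀ = taylorSeries (fun z => ((-1) ^ p *
      ∏ j ∈ (Finset.range p).filter (¬ p ∣ ·), (algebraMap ℚ_[p] ℂ_[p] z + (j : ℂ_[p]))) * G z)
      z₀ := by
    simp only [taylorSeries, hfe.iteratedDeriv_eq]
  rw [PadicInt.coe_add, PadicInt.coe_natCast, ← hz₀, h1, h2,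
    taylorSeries_mul (contDiff_const.mul hprod).contDiffAt hsmooth.contDiffAt,
    taylorSeries_mul contDiff_const.contDiffAt hprod.contDiffAt, taylorSeries_const,
    taylorSeries_prod _ _ _ fun j _ => contDiff_algebraMap_add_const _]
  simp only [taylorSeries_algebraMap_add_const]

theorem not_isDifferentiallyAlgebraic_moritaGammaC :
    ¬ IsDifferentiallyAlgebraic (moritaGammaC p) := by
  rintro ⟨P, hP, hvan⟩
  have hpC : (p : ℂ_[p]) ≠ 0 := by exact_mod_cast hp.out.ne_zero
  -- Starting at p rather than 0 keeps the points at integers ≥ 2, where the product formula shows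
  -- that Γ_p ≠ 0.
  set ξ : ℕ → ℤ_[p] := fun n => p * ((n + 1 : ℕ) : ℤ_[p]) with hξ
  set x : ℕ → ℂ_[p] := fun n => algebraMap ℚ_[p] ℂ_[p] (ξ n : ℚ_[p]) with hx
  have hxn : ∀ n, x n = ((p * (n + 1) : ℕ) : ℂ_[p]) := by
    intro n
    simp [hx, hξ]
  have hinj : Function.Injective x := by
    intro m n h
    rw [hxn, hxn, Nat.cast_inj] at h
    have := Nat.eq_of_mul_eq_mul_left hp.out.pos h
    omega
  have hstep : ∀ n, x (n + 1) = x n + p := by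
    intro n
    rw [hxn, hxn]
    push_cast
    ring
  set y : ℕ → ℕ → ℂ_[p] := fun n k => padicIteratedDeriv k (moritaGammaC p) (ξ n) with hy
  have hξ2 : ∀ n, 2 ≤ p * (n + 1) := fun n =>
    hp.out.two_le.trans (Nat.le_mul_of_pos_right _ n.succ_pos)
  have hy0 : ∀ n, y n 0 ≠ 0 := by
    intro n
    have h1 := moritaGamma_natCast_ne_zero (p := p) _ (hξ2 n)
    simp only [hy, padicIteratedDeriv, iteratedDeriv_zero, zeroExtend_coe, moritaGammaC]
    rw [Ne, map_eq_zero, PadicInt.coe_eq_zero, hξ]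
    simpa using h1
  have hjet : ∀ n, powerSeriesOfJet (y (n + 1)) = PowerSeries.C ((-1) ^ p) *
      (∏ j ∈ (Finset.range p).filter (¬ p ∣ ·),
        (PowerSeries.X + PowerSeries.C (x n + (j : ℂ_[p])))) * powerSeriesOfJet (y n) := by
    intro n
    have h1 := taylorSeries_moritaGammaC_add (p := p) ((n + 1 : ℕ) : ℤ_[p])
    have h2 : ξ (n + 1) = p * ((n + 1 : ℕ) : ℤ_[p]) + p := by
      simp only [hξ]
      push_cast
      ring
    rw [← h2] at h1
    exact h1
  have h1mem : 1 ∈ (Finset.range p).filter (¬ p ∣ ·) :=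
    Finset.mem_filter.2 ⟨Finset.mem_range.2 hp.out.one_lt, hp.out.one_lt.not_ge ∘
      Nat.le_of_dvd one_pos⟩
  refine not_eventually_eval_jet_eq_zero hpC hinj hstep (b := fun j => (j : ℂ_[p]))
    (e := (-1) ^ p) (pow_ne_zero _ (neg_ne_zero.2 one_ne_zero)) h1mem ?_ ?_ hy0 hjet hP ?_
  -- The roots -j with 0 < j < p are pairwise incongruent mod p; `j₀ = 1` serves as the
  -- distinguished one for every p.
  · intro j hj k hk
    have hjp : j < p := Finset.mem_range.1 (Finset.mem_filter.1 hj).1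
    have hj0 : j ≠ 0 := by
      rintro rfl
      exact (Finset.mem_filter.1 hj).2 (dvd_zero p)
    have hkZ : -1 + k * p + j = (0 : ℤ) := by
      have : ((-1 + k * p + j : ℤ) : ℂ_[p]) = 0 := by
        push_cast
        simpa using hk
      exact_mod_cast this
    have hk0 : k = 0 := by
      have hp0 : (0 : ℤ) < p := by exact_mod_cast hp.out.pos
      have hj1 : (1 : ℤ) ≤ j := by exact_mod_cast Nat.one_le_iff_ne_zero.2 hj0
      by_contra hne
      rcases lt_or_gt_of_ne hne with h | h
      · nlinarith [mul_le_mul_of_nonneg_right (show k ≤ -1 by omega) hp0.le]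
      · nlinarith [mul_le_mul_of_nonneg_right (show 1 ≤ k by omega) hp0.le]
    refine ⟨?_, hk0⟩
    rw [hk0] at hkZ
    omega
  · intro n j _
    rw [hxn, ← Nat.cast_add, Nat.cast_ne_zero]
    have := hξ2 n
    omega
  · have hreg : ∀ᶠ n in atTop, P.IsRegularAt (x n) := by
      have h1 : ∀ᶠ n in atTop, ∀ m ∈ P.support, (P.coeff m).denom.eval (x n) ≠ 0 :=
        (eventually_all_finset _).2 fun m _ =>
          eventually_eval_ne_zero hinj (RatFunc.denom_ne_zero _)
      filter_upwards [h1] with n hn m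
      by_cases hm : m ∈ P.support
      · exact hn m hm
      · rw [MvPolynomial.notMem_support_iff.1 hm]
        simp
    filter_upwards [hreg] with n hn using hvan (ξ n) hn

end DifferentialTranscendence

end

/-- For every prime `p` the Morita `p`-adic gamma function is differentially transcendental over
`ℂ_p(X)`. -/
theorem theorem2 (p : ℕ) [Fact p.Prime] :
    IsDifferentiallyTranscendental (moritaGammaC p) :=
  ⟨isSmoothOnPadicInt_moritaGammaC, not_isDifferentiallyAlgebraic_moritaGammaC⟩
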